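/- **Notation.** $\langle u,w\rangle=\int u\,\overline{w}$ is the $L^2$ scalar product, $\mathcal F h(\xi)=\int h(x)e^{-2\pi i\,\xi\cdot x}\,dx$ the Fourier transform (extended to $L^2$), and $T_bh(x)=h(x-b)$. For $s\in\mathbb R$, $a\in\mathbb R^\times=\mathbb R\setminus\{0\}$ put $$N_s=\begin{pmatrix}1&-s\\0&1\end{pmatrix},\quad A_a=a\begin{pmatrix}1&0\\0&|a|^{-1/2}\end{pmatrix},\quad \tilde N_s=\begin{pmatrix}1&0\\-s&1\end{pmatrix},\quad \tilde A_a=a\begin{pmatrix}|a|^{-1/2}&0\\0&1\end{pmatrix},$$ $S_{b,s,a}h(x)=|a|^{-3/4}h(A_a^{-1}N_s^{-1}(x-b))$, $S^{\mathbf v}_{b,s,a}h(x)=|a|^{-3/4}h(\tilde A_a^{-1}\tilde N_s^{-1}(x-b))$, $\mathcal S_\psi f(b,s,a)=\langle f,S_{b,s,a}\psi\rangle$, $\mathcal S^{\mathbf v}_\psi f(b,s,a)=\langle f,S^{\mathbf v}_{b,s,a}\psi\rangle$. Let $C=\{|\xi_2|\le|\xi_1|\}$, $C^{\mathbf v}=\{|\xi_1|\le|\xi_2|\}$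 and $\mathcal F(P_Df)=\chi_D\,\mathcal Ff$ for $D\in\{C,C^{\mathbf v}\}$. Let $\mathcal F\psi^{\mathbf v}(\xi_1,\xi_2)=\mathcal F\psi(\xi_2,\xi_1)$. On $\mathbb R$, $\mathcal W_\chi h(b,a)=\langle h,W_{b,a}\chi\rangle$ with $W_{b,a}\chi(x)=|a|^{-1/2}\chi((x-b)/a)$, and $\mathcal J_0$ is the operator $\mathcal F\mathcal J_0h(\tau)=|\tau|^{1/2}\mathcal Fh(\tau)$ with domain $\{h\in L^2(\mathbb R): |\tau|^{1/2}\mathcal Fh\in L^2(\mathbb R)\}$. The horizontal and vertical affine Radon transforms are $\mathcal Rf(v,t)=\int_{\mathbb R}f(t-vy,y)\,dy$ and $\mathcal R^{\mathbf v}f(v,t)=\int_{\mathbb R}f(x,t-vx)\,dx$. **Hypotheses.** Let $\psi\in L^2(\mathbb R^2)$ be $C^\infty$ with $\int_{\mathbb R^2}|\mathcal F\psi(\xi)|^2|\xi_1|^{-2}\,d\xi=1$ and $\int_{\mathbb R}x_1^N\psi(x_1,x_2)\,dx_1=0$ (with absolute convergence) for all $x_2\in\mathbb R$, $N\in\mathbb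 N$. Assume $\mathcal F\psi(\xi_1,\xi_2)=\mathcal F\psi_1(\xi_1)\,\mathcal F\psi_2(\xi_2/\xi_1)$ for a.e. $\xi$, with $\psi_1,\psi_2\in L^2(\mathbb R)$ and $$0<\int_{\mathbb R}\frac{|\mathcal F\psi_1(\tau)|^2}{|\tau|}\,d\tau<\infty,\qquad \int_{\mathbb R}|\tau||\mathcal F\psi_1(\tau)|^2\,d\tau<\infty,\qquad \int_{\mathbb R}|\tau|^2|\mathcal F\psi_1(\tau)|^2\,d\tau<\infty.$$ Let $g\in L^1(\mathbb R^2)\cap L^2(\mathbb R^2)$ be $C^\infty$ and such that for a.e. $\xi\in\mathbb R^2$ $$|\mathcal Fg(\xi)|^2+\chi_C(\xi)\int_{-1}^1\int_{-2}^2|\mathcal F\psi(A_a{}^tN_s\xi)|^2\,ds\frac{da}{|a|^{3/2}}+\chi_{C^{\mathbf v}}(\xi)\int_{-1}^1\int_{-2}^2|\mathcal F\psi^{\mathbf v}(\tilde A_aN_s\xi)|^2\,ds\frac{da}{|a|^{3/2}}=1.\tag{W}$$ **Conclusion.** For every $f\in L^1(\mathbb R^2)\cap L^2(\mathbb R^2)$,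 $$\|f\|^2=\int_{\mathbb R^2}|\langle f,T_bg\rangle|^2\,db+\int_{-1}^1\int_{-2}^2\int_{\mathbb R^2}|\mathcal S_\psi[P_Cf](b,s,a)|^2\,db\,ds\frac{da}{|a|^3}+\int_{-1}^1\int_{-2}^2\int_{\mathbb R^2}|\mathcal S^{\mathbf v}_{\psi^{\mathbf v}}[P_{C^{\mathbf v}}f](b,s,a)|^2\,db\,ds\frac{da}{|a|^3}.$$ Moreover $\mathcal Rf(v,\cdot),\mathcal R^{\mathbf v}f(v,\cdot)\in L^2(\mathbb R)$ for a.e. $v$, and for all $(x,y)\in\mathbb R^2$, $s\in\mathbb R$, $a\in\mathbb R^\times$, $$\mathcal S_\psi[P_Cf](x,y,s,a)=|a|^{-3/4}\int_{-1}^1\mathcal W_{\chi_1}(\mathcal Rf(v,\cdot))(x+vy,a)\,\overline{\phi_2\Big(\tfrac{v-s}{|a|^{1/2}}\Big)}\,dv,$$ $$\mathcal S^{\mathbf v}_{\psi^{\mathbf v}}[P_{C^{\mathbf v}}f](x,y,s,a)=|a|^{-3/4}\int_{-1}^1\mathcal W_{\chi_1}(\mathcal R^{\mathbf v}f(v,\cdot))(vx+y,a)\,\overline{\phi_2\Big(\tfrac{v-s}{|a|^{1/2}}\Big)}\,dv,$$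 where $\mathcal F\chi_1(\tau)=|\tau|\mathcal F\psi_1(\tau)$ and $\phi_2=\mathcal F\psi_2$, the integrals over $v$ being absolutely convergent. Finally, if $\zeta(v,\cdot)=\mathcal J_0^2\,\mathcal Rg(v,\cdot)$ is defined for a.e. $v$ (that is, $\mathcal Rg(v,\cdot)$ and $\mathcal J_0\mathcal Rg(v,\cdot)$ lie in the domain of $\mathcal J_0$), then for all $(x,y)\in\mathbb R^2$ $$\langle f,T_{(x,y)}g\rangle=\int_{\mathbb R}\langle\mathcal Rf(v,\cdot),T_{x+vy}\zeta(v,\cdot)\rangle\,dv,$$ with absolute convergence; and $\zeta(v,\cdot)$ is defined for a.e. $v$ whenever $\psi$ or $g$ has square-integrable derivatives of all orders. -/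

import Mathlib

open MeasureTheory FourierTransform
open scoped ENNReal ContDiff

namespace ConeShearlet

noncomputable section

/-- The Euclidean plane. -/
abbrev Plane : Type := EuclideanSpace ℝ (Fin 2)

/-! ### Generalities on `L²` -/

open Classical in
/-- The class in `L²` of a square-integrable function (and `0` if the function is not
square-integrable). -/
def toL2 {E : Type*} [MeasureSpace E] (h : E → ℂ) : Lp ℂ 2 (volume : Measure E) :=
  if hh : MemLp h 2 volume then hh.toLp h else 0

/-- The Fourier transform of a square-integrable function, as an almost everywhere defined
function; on `L¹ ∩ L²` it is the integral of `h x * exp (-2πi ξ·x)`. -/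
def fourierL2 {E : Type*} [NormedAddCommGroup E] [InnerProductSpace ℝ E]
    [FiniteDimensional ℝ E] [MeasurableSpace E] [BorelSpace E] (h : E → ℂ) : E → ℂ :=
  ⇑(𝓕 (toL2 h : Lp ℂ 2 (volume : Measure E)) : Lp ℂ 2 (volume : Measure E))

/-- The square-integrable function with a given square-integrable Fourier transform. -/
def fourierInvL2 {E : Type*} [NormedAddCommGroup E] [InnerProductSpace ℝ E]
    [FiniteDimensional ℝ E] [MeasurableSpace E] [BorelSpace E] (h : E → ℂ) : E → ℂ :=
  ⇑(𝓕⁻ (toL2 h : Lp ℂ 2 (volume : Measure E)) : Lp ℂ 2 (volume : Measure E))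

/-- The `L²` scalar product, linear in the first argument. -/
def ip {E : Type*} [MeasureSpace E] (u w : E → ℂ) : ℂ :=
  ∫ x, u x * star (w x)

/-- The translation operator `T_b h (x) = h (x - b)`. -/
def translateBy {E : Type*} [Sub E] (b : E) (h : E → ℂ) : E → ℂ := fun x => h (x - b)

/-! ### One-dimensional wavelets -/

/-- `W_{b,a} h (x) = |a|^{-1/2} h ((x - b) / a)`. -/
def waveletRep (b a : ℝ) (h : ℝ → ℂ) : ℝ → ℂ := fun x =>
  ((|a| ^ (-(1 / 2 : ℝ)) : ℝ) : ℂ) * h ((x - b) / a)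

/-- The wavelet transform `𝒲_χ h (b, a) = ⟨h, W_{b,a} χ⟩`. -/
def waveletTransform (χ h : ℝ → ℂ) (b a : ℝ) : ℂ := ip h (waveletRep b a χ)

/-- The domain of `J₀`: square-integrable `h` with `|τ|^{1/2} ℱh(τ)` square-integrable. -/
def MemDomJ0 (h : ℝ → ℂ) : Prop :=
  MemLp h 2 volume ∧
    MemLp (fun τ : ℝ => ((|τ| ^ (1 / 2 : ℝ) : ℝ) : ℂ) * fourierL2 h τ) 2 volume

/-- The operator `J₀`, the Fourier multiplier with symbol `|τ|^{1/2}`. -/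
def J0 (h : ℝ → ℂ) : ℝ → ℂ :=
  fourierInvL2 (fun τ : ℝ => ((|τ| ^ (1 / 2 : ℝ) : ℝ) : ℂ) * fourierL2 h τ)

/-- The function `χ₁` with `ℱχ₁(τ) = |τ| ℱψ₁(τ)`. -/
def chiOne (ψ₁ : ℝ → ℂ) : ℝ → ℂ :=
  fourierInvL2 (fun τ : ℝ => ((|τ| : ℝ) : ℂ) * fourierL2 ψ₁ τ)

/-! ### Shearlets, horizontal and vertical -/

/-- The shearing matrix `N_s`. -/
def shear (s : ℝ) : Matrix (Fin 2) (Fin 2) ℝ := !![1, -s; 0, 1]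

/-- The dilation matrix `A_a`. -/
def dil (a : ℝ) : Matrix (Fin 2) (Fin 2) ℝ := a • !![1, 0; 0, |a| ^ (-(1 / 2 : ℝ))]

/-- The vertical shearing matrix. -/
def shearV (s : ℝ) : Matrix (Fin 2) (Fin 2) ℝ := !![1, 0; -s, 1]

/-- The vertical dilation matrix. -/
def dilV (a : ℝ) : Matrix (Fin 2) (Fin 2) ℝ := a • !![|a| ^ (-(1 / 2 : ℝ)), 0; 0, 1]

/-- Action of a matrix on the plane. -/
def act (M : Matrix (Fin 2) (Fin 2) ℝ) (x : Plane) : Plane := Matrix.toEuclideanLin M x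

/-- `S_{b,s,a} h (x) = |a|^{-3/4} h (A_a⁻¹ N_s⁻¹ (x - b))`. -/
def shearletRep (b : Plane) (s a : ℝ) (h : Plane → ℂ) : Plane → ℂ := fun x =>
  ((|a| ^ (-(3 / 4 : ℝ)) : ℝ) : ℂ) * h (act (dil a)⁻¹ (act (shear s)⁻¹ (x - b)))

/-- The vertical shearlet representation. -/
def shearletRepV (b : Plane) (s a : ℝ) (h : Plane → ℂ) : Plane → ℂ := fun x =>
  ((|a| ^ (-(3 / 4 : ℝ)) : ℝ) : ℂ) * h (act (dilV a)⁻¹ (act (shearV s)⁻¹ (x - b)))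

/-- The shearlet transform `⟨h, S_{b,s,a} ψ⟩`. -/
def shearletTransform (ψ h : Plane → ℂ) (b : Plane) (s a : ℝ) : ℂ :=
  ip h (shearletRep b s a ψ)

/-- The vertical shearlet transform. -/
def shearletTransformV (ψ h : Plane → ℂ) (b : Plane) (s a : ℝ) : ℂ :=
  ip h (shearletRepV b s a ψ)

/-- The function `ψᵛ` with `ℱψᵛ(ξ₁, ξ₂) = ℱψ(ξ₂, ξ₁)`. -/
def swapped (ψ : Plane → ℂ) : Plane → ℂ :=
  fourierInvL2 (fun ξ : Plane => fourierL2 ψ !₂[ξ 1, ξ 0])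

/-! ### Cones and frequency projections -/

/-- The horizontal cone `|ξ₂/ξ₁| ≤ 1`. -/
def coneH : Set Plane := {ξ | |ξ 1| ≤ |ξ 0|}

/-- The vertical cone `|ξ₁/ξ₂| ≤ 1`. -/
def coneV : Set Plane := {ξ | |ξ 0| ≤ |ξ 1|}

/-- The frequency projection: `ℱ(P_D f) = χ_D ℱf`. -/
def freqProj (D : Set Plane) (f : Plane → ℂ) : Plane → ℂ :=
  fourierInvL2 (D.indicator (fourierL2 f))

/-- The admissibility constant `∫ |ℱψ(ξ)|² / |ξ₁|² dξ`, with values in `[0, ∞]`. -/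
def admConst (ψ : Plane → ℂ) : ℝ≥0∞ :=
  ∫⁻ ξ : Plane, ‖fourierL2 ψ ξ‖ₑ ^ 2 / ‖ξ 0‖ₑ ^ 2

/-- Infinitely many directional vanishing moments in the `x₁`-direction. -/
def VanishingMoments (ψ : Plane → ℂ) : Prop :=
  ∀ (x₂ : ℝ) (N : ℕ),
    Integrable (fun x₁ : ℝ => (x₁ : ℂ) ^ N * ψ !₂[x₁, x₂]) volume ∧
      ∫ x₁ : ℝ, (x₁ : ℂ) ^ N * ψ !₂[x₁, x₂] = 0

/-- The window condition relating `g` to `ψ`: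
`|ℱg(ξ)|² + χ_C(ξ) ∫_{-1}^1 ∫_{-2}^2 |ℱψ(A_a ᵗN_s ξ)|² ds da/|a|^{3/2}`
`+ χ_{Cᵛ}(ξ) ∫_{-1}^1 ∫_{-2}^2 |ℱψᵛ(Ãₐ N_s ξ)|² ds da/|a|^{3/2} = 1` for almost every `ξ`. -/
def WindowCondition (ψ g : Plane → ℂ) : Prop :=
  ∀ᵐ ξ : Plane,
    ‖fourierL2 g ξ‖ₑ ^ 2
      + coneH.indicator (fun ξ => ∫⁻ a in Set.Icc (-1 : ℝ) 1, ∫⁻ s in Set.Icc (-2 : ℝ) 2,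
          ‖fourierL2 ψ (act (dil a) (act (shear s).transpose ξ))‖ₑ ^ 2
            * ENNReal.ofReal (|a| ^ (-(3 / 2 : ℝ)))) ξ
      + coneV.indicator (fun ξ => ∫⁻ a in Set.Icc (-1 : ℝ) 1, ∫⁻ s in Set.Icc (-2 : ℝ) 2,
          ‖fourierL2 (swapped ψ) (act (dilV a) (act (shear s) ξ))‖ₑ ^ 2
            * ENNReal.ofReal (|a| ^ (-(3 / 2 : ℝ)))) ξ
      = 1

/-! ### Affine Radon transforms -/

/-- The horizontal affine Radon transform `ℛf(v,t) = ∫ f(t - v y, y) dy`. -/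
def radonH (f : Plane → ℂ) (v t : ℝ) : ℂ := ∫ y : ℝ, f !₂[t - v * y, y]

/-- The vertical affine Radon transform `ℛᵛf(v,t) = ∫ f(x, t - v x) dx`. -/
def radonV (f : Plane → ℂ) (v t : ℝ) : ℂ := ∫ x : ℝ, f !₂[x, t - v * x]

end

end ConeShearlet

/-! Everything is read off on the Fourier side. For fixed `s` and `a ≠ 0`, the coefficient of `P_C
f`, as a function of `b`, is the inverse Fourier transform of the integrable function `|a|^{3/4} χ_C
ℱf(ξ) star (ℱψ(A_a ᵗN_s ξ))`. Plancherel in `b` and Tonelli turn the three terms of the norm formula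
into the integral of `|ℱf|²` against the left side of the window condition, which is 1
(`lintegral_expI_sq`, `reconstruction`).

For the Radon formulas the frequency plane is written as `ξ = (τ, vτ)`, with `dξ = |τ| dτ dv`
(`map_slopeMap`). By the slice theorem (`fourier_radonH`), `ℱf(τ, vτ)` is the transform of `ℛf(v,
·)` at `τ`; the horizontal cone becomes `|v| ≤ 1`; and the product form of `ℱψ` separates `ℱψ₁(aτ)`
from `ℱψ₂((v - s)/|a|^{1/2})`. The Jacobian `|τ|` is absorbed by `χ₁` in the shearlet coefficients
and by `J₀²` in the window coefficients (`shearlet_coefficients`, `window_coefficients`). The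
vertical formulas follow by exchanging the two coordinates (`shearletTransformV_eq`).

It remains to see that `|τ| ℱg(τ, vτ)` is square-integrable in `τ` for almost every `v`. If `g` has
square-integrable derivatives, one derivative suffices (`ae_slice_of_window_smooth`). If `ψ` has,
the admissibility integral, which is 1, splits over all dilations and shears; comparison with the
window condition bounds `|ℱg|²` on each cone by the part with `|a| > 1` or `|s| > 2`
(`one_le_window_add_tail`, `ae_window_le_tailBound`). The eighth moment of `|ℱψ₂|²`, finite because
a fourth derivative of `ψ` is in `L²`, makes that part integrable against `|τ|²`
(`lintegral_sq_mul_tailBound`). -/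

namespace ConeShearlet

/-! ### The Fourier transform of square-integrable functions -/

section FourierL2

variable {E : Type*} [NormedAddCommGroup E] [InnerProductSpace ℝ E]
  [FiniteDimensional ℝ E] [MeasurableSpace E] [BorelSpace E]

theorem toL2_eq_toLp {h : E → ℂ} (hh : MemLp h 2 volume) : toL2 h = hh.toLp h := dif_pos hh

theorem coeFn_toL2 {h : E → ℂ} (hh : MemLp h 2 volume) : (toL2 h : E → ℂ) =ᵐ[volume] h := by
  rw [toL2_eq_toLp hh]; exact hh.coeFn_toLp

theorem toL2_congr {h k : E → ℂ} (hk : h =ᵐ[volume] k) : toL2 h = toL2 k := by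
  by_cases hh : MemLp h 2 volume
  · rw [toL2_eq_toLp hh, toL2_eq_toLp ((memLp_congr_ae hk).1 hh)]
    exact MemLp.toLp_congr _ _ hk
  · rw [toL2, toL2, dif_neg hh, dif_neg (fun h' => hh ((memLp_congr_ae hk).2 h'))]

theorem toL2_coeFn (u : Lp ℂ 2 (volume : Measure E)) : toL2 (u : E → ℂ) = u := by
  rw [toL2_eq_toLp (Lp.memLp u), Lp.toLp_coeFn]

theorem memLp_fourierL2 (h : E → ℂ) : MemLp (fourierL2 h) 2 volume := Lp.memLp _

theorem memLp_fourierInvL2 (h : E → ℂ) : MemLp (fourierInvL2 h) 2 volume := Lp.memLp _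

theorem stronglyMeasurable_fourierL2 (h : E → ℂ) : StronglyMeasurable (fourierL2 h) :=
  Lp.stronglyMeasurable _

theorem measurable_enorm_fourierL2 (h : E → ℂ) : Measurable fun ξ => ‖fourierL2 h ξ‖ₑ :=
  (stronglyMeasurable_fourierL2 h).measurable.enorm

theorem fourierInvL2_congr {h k : E → ℂ} (hk : h =ᵐ[volume] k) :
    fourierInvL2 h = fourierInvL2 k := by
  rw [fourierInvL2, fourierInvL2, toL2_congr hk]

theorem fourierL2_fourierInvL2 {h : E → ℂ} (hh : MemLp h 2 volume) :
    fourierL2 (fourierInvL2 h) =ᵐ[volume] h := by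
  rw [fourierL2, fourierInvL2, toL2_coeFn, fourier_fourierInv_eq]
  exact coeFn_toL2 hh

theorem fourierInvL2_fourierL2 {h : E → ℂ} (hh : MemLp h 2 volume) :
    fourierInvL2 (fourierL2 h) =ᵐ[volume] h := by
  rw [fourierL2, fourierInvL2, toL2_coeFn, fourierInv_fourier_eq]
  exact coeFn_toL2 hh

/-- Plancherel's identity. -/
theorem eLpNorm_fourierL2 {h : E → ℂ} (hh : MemLp h 2 volume) :
    eLpNorm (fourierL2 h) 2 volume = eLpNorm h 2 volume := by
  have h1 := Lp.norm_fourier_eq (toL2 h : Lp ℂ 2 (volume : Measure E))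
  rw [Lp.norm_def, Lp.norm_def, ENNReal.toReal_eq_toReal_iff' (Lp.eLpNorm_ne_top _)
    (Lp.eLpNorm_ne_top _)] at h1
  rw [fourierL2, h1]
  exact eLpNorm_congr_ae (coeFn_toL2 hh)

theorem eLpNorm_two_sq (h : E → ℂ) : eLpNorm h 2 volume ^ 2 = ∫⁻ x, ‖h x‖ₑ ^ 2 := by
  have := eLpNorm_nnreal_pow_eq_lintegral (f := h) (μ := (volume : Measure E)) (p := 2)
    (by norm_num)
  simpa using this

/-- Parseval's identity. -/
theorem ip_eq_integral_fourierL2 {u w : E → ℂ} (hu : MemLp u 2 volume) (hw : MemLp w 2 volume) :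
    ip u w = ∫ ξ, fourierL2 u ξ * star (fourierL2 w ξ) := by
  have h1 := Lp.inner_fourier_eq (toL2 w : Lp ℂ 2 (volume : Measure E)) (toL2 u)
  rw [L2.inner_def, L2.inner_def] at h1
  simp only [RCLike.inner_apply] at h1
  rw [fourierL2, fourierL2, ip]
  refine Eq.trans ?_ h1.symm
  refine integral_congr_ae ?_
  filter_upwards [coeFn_toL2 hu, coeFn_toL2 hw] with x hx hx'
  rw [hx, hx']; rfl

theorem integrable_mul_star_fourierL2 (u w : E → ℂ) :
    Integrable fun ξ => fourierL2 u ξ * star (fourierL2 w ξ) :=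
  (memLp_fourierL2 u).integrable_mul (memLp_fourierL2 w).star

/-- The Fourier transform is symmetric with respect to the bilinear pairing. -/
theorem integral_fourierL2_mul_schwartz {h : E → ℂ} (hh : MemLp h 2 volume) (φ : SchwartzMap E ℂ) :
    ∫ ξ, fourierL2 h ξ * φ ξ = ∫ x, h x * 𝓕 (φ : E → ℂ) x := by
  have h1 := congrArg (fun T : TemperedDistribution E ℂ => T φ)
    (Lp.fourier_toTemperedDistribution_eq (toL2 h : Lp ℂ 2 (volume : Measure E)))
  simp only [TemperedDistribution.fourier_apply, Lp.toTemperedDistribution_apply,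
    smul_eq_mul] at h1
  calc _ = ∫ ξ, φ ξ * fourierL2 h ξ := by simp only [mul_comm]
    _ = _ := h1.symm
    _ = _ := by
      refine integral_congr_ae ?_
      filter_upwards [coeFn_toL2 hh] with x hx
      rw [hx, mul_comm, SchwartzMap.fourier_coe]

/-- Smooth compactly supported functions are Schwartz, and they already separate locally integrable
functions. -/
theorem ae_eq_of_integral_mul_schwartz {u w : E → ℂ} (hu : LocallyIntegrable u volume)
    (hw : LocallyIntegrable w volume)
    (h : ∀ φ : SchwartzMap E ℂ, ∫ x, u x * φ x = ∫ x, w x * φ x) : u =ᵐ[volume] w := by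
  refine ae_eq_of_integral_contDiff_smul_eq hu hw fun g g_smooth g_cpt => ?_
  have hg₁ : HasCompactSupport (Complex.ofRealCLM ∘ g) := g_cpt.comp_left rfl
  have hg₂ : ContDiff ℝ ∞ (Complex.ofRealCLM ∘ g) := by fun_prop
  have := h (hg₁.toSchwartzMap hg₂)
  simpa [mul_comm] using this

/-- The tool for computing `L²` transforms, which have no pointwise formula: a candidate is verified
by pairing it with Schwartz functions. -/
theorem fourierL2_ae_eq {h k : E → ℂ} (hh : MemLp h 2 volume) (hk : LocallyIntegrable k volume)
    (H : ∀ φ : SchwartzMap E ℂ, ∫ x, h x * 𝓕 (φ : E → ℂ) x = ∫ ξ, k ξ * φ ξ) :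
    fourierL2 h =ᵐ[volume] k :=
  ae_eq_of_integral_mul_schwartz ((memLp_fourierL2 h).locallyIntegrable one_le_two) hk
    fun φ => (integral_fourierL2_mul_schwartz hh φ).trans (H φ)

theorem integral_fourier_mul {u w : E → ℂ} (hu : Integrable u) (hw : Integrable w) :
    ∫ ξ, 𝓕 u ξ * w ξ = ∫ x, u x * 𝓕 w x := by
  have := VectorFourier.integral_fourierIntegral_smul_eq_flip (μ := (volume : Measure E))
    (ν := (volume : Measure E)) (L := innerₗ E) Real.continuous_fourierChar continuous_inner hu hw
  simp only [flip_innerₗ, smul_eq_mul] at this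
  exact this

theorem continuous_fourier {h : E → ℂ} (hh : Integrable h) : Continuous (𝓕 h) :=
  VectorFourier.fourierIntegral_continuous Real.continuous_fourierChar continuous_inner hh

theorem norm_fourier_le (h : E → ℂ) (ξ : E) : ‖𝓕 h ξ‖ ≤ ∫ x, ‖h x‖ :=
  VectorFourier.norm_fourierIntegral_le_integral_norm _ _ _ _ _

theorem fourierL2_ae_eq_fourier {h : E → ℂ} (hh₁ : Integrable h) (hh₂ : MemLp h 2 volume) :
    fourierL2 h =ᵐ[volume] 𝓕 h :=
  fourierL2_ae_eq hh₂ (continuous_fourier hh₁).locallyIntegrable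
    fun φ => (integral_fourier_mul hh₁ φ.integrable).symm

/-- An integrable function with square-integrable Fourier transform is square-integrable. -/
theorem memLp_two_of_fourier {h : E → ℂ} (hh : Integrable h) (hF : MemLp (𝓕 h) 2 volume) :
    MemLp h 2 volume := by
  refine (memLp_congr_ae ?_).1 (memLp_fourierInvL2 (𝓕 h))
  refine ae_eq_of_integral_mul_schwartz
    ((memLp_fourierInvL2 _).locallyIntegrable one_le_two) hh.locallyIntegrable fun φ => ?_
  -- Writing `φ = 𝓕 (𝓕⁻ φ)` moves the transform to the other factor in both pairings, so both equal
  -- the pairing of `𝓕 h` with `𝓕⁻ φ`.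
  have h1 := integral_fourierL2_mul_schwartz (memLp_fourierInvL2 (𝓕 h)) (𝓕⁻ φ)
  rw [← SchwartzMap.fourier_coe, fourier_fourierInv_eq] at h1
  rw [← h1]
  have h2 := integral_fourier_mul hh (𝓕⁻ φ).integrable
  rw [← SchwartzMap.fourier_coe, fourier_fourierInv_eq] at h2
  rw [← h2]
  refine integral_congr_ae ?_
  filter_upwards [fourierL2_fourierInvL2 hF] with x hx
  rw [hx]

theorem star_mem_L2 {h : E → ℂ} (hh : MemLp h 2 volume) :
    MemLp (fun x => star (h x)) 2 volume := hh.star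

/-- The Fourier transform is symmetric with respect to the bilinear pairing. -/
theorem integral_fourierL2_mul {u w : E → ℂ} (hu : MemLp u 2 volume) (hw : MemLp w 2 volume) :
    ∫ ξ, fourierL2 u ξ * w ξ = ∫ x, u x * fourierL2 w x := by
  have key : ∀ (a b : E → ℂ), MemLp a 2 volume → MemLp b 2 volume →
      ∫ x, a x * b x = inner ℂ (toL2 fun x => star (a x)) (toL2 b) := by
    intro a b ha hb
    rw [L2.inner_def]
    refine integral_congr_ae ?_
    filter_upwards [coeFn_toL2 (star_mem_L2 ha), coeFn_toL2 hb] with x hx hx'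
    rw [hx, hx', RCLike.inner_apply]
    simp [mul_comm]
  rw [key _ _ (memLp_fourierL2 u) hw, key _ _ hu (memLp_fourierL2 w)]
  rw [show toL2 (fourierL2 w) = 𝓕 (toL2 w) from toL2_coeFn _]
  generalize toL2 w = W
  -- Both sides are continuous in the second function, so density reduces the claim to Schwartz
  -- functions.
  refine DenseRange.induction_on (SchwartzMap.denseRange_toLpCLM (E := E) (F := ℂ)
    (p := 2) (μ := volume) ENNReal.ofNat_ne_top) W ?_ fun φ => ?_
  · exact isClosed_eq (continuous_const.inner continuous_id)
      (continuous_const.inner (Lp.fourierTransformₗᵢ E ℂ).continuous)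
  · have e1 : toL2 (φ : E → ℂ) = φ.toLp 2 volume := toL2_eq_toLp (φ.memLp 2 volume)
    have e2 : toL2 (𝓕 φ : SchwartzMap E ℂ) = (𝓕 φ).toLp 2 volume :=
      toL2_eq_toLp ((𝓕 φ).memLp 2 volume)
    simp only [SchwartzMap.toLpCLM_apply]
    rw [SchwartzMap.toLp_fourier_eq, ← e1, ← e2, ← key _ _ (memLp_fourierL2 u) (φ.memLp 2 volume),
      ← key _ _ hu ((𝓕 φ).memLp 2 volume)]
    exact integral_fourierL2_mul_schwartz hu φ

theorem integral_fourierL2_mul_eq_fourier {u w : E → ℂ} (hu : MemLp u 2 volume)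
    (hw₁ : Integrable w) (hw : MemLp w 2 volume) :
    ∫ ξ, fourierL2 u ξ * w ξ = ∫ x, u x * 𝓕 w x := by
  rw [integral_fourierL2_mul hu hw]
  refine integral_congr_ae ?_
  filter_upwards [fourierL2_ae_eq_fourier hw₁ hw] with x hx
  rw [hx]

/-- The character `x ↦ exp (2πi t)` with complex values. -/
noncomputable def expI (t : ℝ) : ℂ := (Real.fourierChar t : ℂ)

theorem continuous_expI : Continuous expI :=
  continuous_subtype_val.comp Real.continuous_fourierChar

@[simp] theorem norm_expI (t : ℝ) : ‖expI t‖ = 1 := Circle.norm_coe _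

@[simp] theorem enorm_expI (t : ℝ) : ‖expI t‖ₑ = 1 := by
  rw [← ofReal_norm, norm_expI, ENNReal.ofReal_one]

theorem expI_add (s t : ℝ) : expI (s + t) = expI s * expI t := by
  simp [expI, AddChar.map_add_eq_mul]

theorem star_expI (t : ℝ) : star (expI t) = expI (-t) := by
  simp [expI, AddChar.map_neg_eq_inv]

theorem fourier_eq_expI (h : E → ℂ) (ξ : E) :
    𝓕 h ξ = ∫ x, expI (-(inner ℝ x ξ)) * h x := by
  rw [Real.fourier_eq]; rfl

/-! ### Modulations, translations, linear changes of variables and derivatives -/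

theorem memLp_expI_mul {p : ℝ≥0∞} {h : E → ℂ} (hh : MemLp h p volume) (b : E) :
    MemLp (fun x => expI (-(inner ℝ b x)) * h x) p volume := by
  refine (memLp_congr_norm (f := h) hh.1 ?_ ?_).1 hh
  · exact (continuous_expI.comp (by fun_prop)).aestronglyMeasurable.mul hh.1
  · exact Filter.Eventually.of_forall fun x => by simp

theorem memLp_translateBy {p : ℝ≥0∞} {h : E → ℂ} (hh : MemLp h p volume) (b : E) :
    MemLp (translateBy b h) p volume :=
  hh.comp_measurePreserving (measurePreserving_sub_right volume b)

theorem fourierL2_translateBy {h : E → ℂ} (hh : MemLp h 2 volume) (b : E) :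
    fourierL2 (translateBy b h) =ᵐ[volume] fun ξ => expI (-(inner ℝ b ξ)) * fourierL2 h ξ := by
  refine fourierL2_ae_eq (memLp_translateBy hh b)
    ((memLp_expI_mul (memLp_fourierL2 h) b).locallyIntegrable one_le_two) fun φ => ?_
  have h1 : MemLp (fun x => expI (-(inner ℝ b x)) * φ x) 1 volume :=
    memLp_expI_mul (φ.memLp 1 volume) b
  have h2 := integral_fourierL2_mul_eq_fourier hh (memLp_one_iff_integrable.1 h1)
    (memLp_expI_mul (φ.memLp 2 volume) b)
  calc ∫ x, translateBy b h x * 𝓕 (φ : E → ℂ) x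
      = ∫ x, (fun y => h y * 𝓕 (φ : E → ℂ) (y + b)) (x - b) := by simp [translateBy]
    _ = ∫ y, h y * 𝓕 (φ : E → ℂ) (y + b) :=
      integral_sub_right_eq_self (fun y => h y * 𝓕 (φ : E → ℂ) (y + b)) b
    _ = ∫ y, h y * 𝓕 (fun x => expI (-(inner ℝ b x)) * φ x) y := by
      congr 1 with y
      rw [fourier_eq_expI, fourier_eq_expI]
      congr 2 with x
      rw [inner_add_right, neg_add, expI_add, real_inner_comm x b, mul_assoc]
    _ = _ := by rw [← h2]; congr 1 with ξ; ring

theorem map_linearEquiv_volume (P : E ≃ₗ[ℝ] E) :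
    Measure.map P (volume : Measure E) =
      ENNReal.ofReal |(LinearMap.det (P : E →ₗ[ℝ] E))⁻¹| • volume :=
  Measure.map_linearMap_addHaar_eq_smul_addHaar volume P.isUnit_det'.ne_zero

theorem quasiMeasurePreserving_linearEquiv (P : E ≃ₗ[ℝ] E) :
    Measure.QuasiMeasurePreserving P (volume : Measure E) volume :=
  ⟨P.toContinuousLinearEquiv.continuous.measurable, by
    rw [map_linearEquiv_volume]; exact Measure.smul_absolutelyContinuous⟩

theorem integral_comp_linearEquiv (P : E ≃ₗ[ℝ] E) (F : E → ℂ) :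
    ∫ x, F (P x) = (|(LinearMap.det (P : E →ₗ[ℝ] E))⁻¹| : ℝ) * ∫ x, F x := by
  have h1 := integral_map_equiv (μ := (volume : Measure E))
    P.toContinuousLinearEquiv.toHomeomorph.toMeasurableEquiv F
  have h2 : Measure.map (P.toContinuousLinearEquiv.toHomeomorph.toMeasurableEquiv)
    (volume : Measure E) = _ := map_linearEquiv_volume P
  rw [h2, integral_smul_measure, ENNReal.toReal_ofReal (abs_nonneg _)] at h1
  rw [← Complex.real_smul, h1]; rfl

theorem memLp_comp_linearEquiv {p : ℝ≥0∞} {h : E → ℂ} (hh : MemLp h p volume) (P : E ≃ₗ[ℝ] E) :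
    MemLp (fun x => h (P x)) p volume := by
  have h1 : MemLp h p (Measure.map P volume) := by
    rw [map_linearEquiv_volume]; exact hh.smul_measure ENNReal.ofReal_ne_top
  exact h1.comp_of_map P.toContinuousLinearEquiv.continuous.aemeasurable

/-- The Fourier transform intertwines a linear change of variables with its contragredient. -/
theorem fourierL2_comp_linearEquiv {h : E → ℂ} (hh : MemLp h 2 volume) (P Q : E ≃ₗ[ℝ] E)
    (hPQ : ∀ ξ x, inner ℝ (Q ξ) (P x) = inner ℝ ξ x)
    (hdet : |LinearMap.det (Q : E →ₗ[ℝ] E)| = |(LinearMap.det (P : E →ₗ[ℝ] E))⁻¹|) :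
    fourierL2 (fun x => h (P x)) =ᵐ[volume]
      fun ξ => (|LinearMap.det (Q : E →ₗ[ℝ] E)| : ℝ) * fourierL2 h (Q ξ) := by
  refine fourierL2_ae_eq (memLp_comp_linearEquiv hh P) (((memLp_comp_linearEquiv
    (memLp_fourierL2 h) Q).const_mul _).locallyIntegrable one_le_two) fun φ => ?_
  set d : ℝ := LinearMap.det (Q : E →ₗ[ℝ] E) with hd
  have hd0 : |d| ≠ 0 := abs_ne_zero.2 Q.isUnit_det'.ne_zero
  -- For test functions the rule is the classical substitution; duality then carries it over to `h`.
  have h1 : ∀ y, 𝓕 (fun ζ => φ (Q.symm ζ)) y = (|d| : ℝ) * 𝓕 (φ : E → ℂ) (P.symm y) := by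
    intro y
    rw [fourier_eq_expI, fourier_eq_expI]
    have := integral_comp_linearEquiv Q
      (fun ζ => expI (-(inner ℝ ζ y)) * φ (Q.symm ζ))
    have e : ∀ ξ, inner ℝ (Q ξ) y = inner ℝ ξ (P.symm y) := fun ξ => by
      rw [← hPQ ξ (P.symm y), P.apply_symm_apply]
    simp only [LinearEquiv.symm_apply_apply, e] at this
    rw [this, ← mul_assoc, ← Complex.ofReal_mul, ← hd, abs_inv, mul_inv_cancel₀ hd0]
    simp
  have hm : ∀ p, MemLp (fun ζ => φ (Q.symm ζ)) p volume := fun p =>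
    memLp_comp_linearEquiv (φ.memLp p volume) Q.symm
  have h2 := integral_fourierL2_mul_eq_fourier hh (memLp_one_iff_integrable.1 (hm 1)) (hm 2)
  have h3 := integral_comp_linearEquiv Q (fun ζ => fourierL2 h ζ * φ (Q.symm ζ))
  have h4 := integral_comp_linearEquiv P (fun x => h x * 𝓕 (φ : E → ℂ) (P.symm x))
  simp only [LinearEquiv.symm_apply_apply] at h3 h4
  rw [h4, ← hdet]
  simp only [mul_assoc]
  rw [integral_const_mul, h3, h2, ← hd]
  simp only [h1]
  rw [← integral_const_mul, abs_inv, ← mul_assoc, ← Complex.ofReal_mul, mul_inv_cancel₀ hd0,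
    Complex.ofReal_one, one_mul]
  congr 1 with x
  ring

/-- The Fourier transform of a square-integrable directional derivative. -/
theorem fourierL2_fderiv {h : E → ℂ} (hh : MemLp h 2 volume) (hd : Differentiable ℝ h) (m : E)
    (hm : MemLp (fun x => fderiv ℝ h x m) 2 volume) :
    fourierL2 (fun x => fderiv ℝ h x m) =ᵐ[volume]
      fun ξ => (2 * Real.pi * Complex.I) * (inner ℝ ξ m : ℝ) * fourierL2 h ξ := by
  have hc : Continuous fun ξ : E => (2 * Real.pi * Complex.I) * ((inner ℝ ξ m : ℝ) : ℂ) := by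
    fun_prop
  refine fourierL2_ae_eq hm ?_ fun φ => ?_
  · rw [← locallyIntegrableOn_univ]
    exact (((memLp_fourierL2 h).locallyIntegrable one_le_two).locallyIntegrableOn _).continuousOn_mul
      hc.continuousOn isOpen_univ.isLocallyClosed
  · have hg : (fun ξ : E => inner ℝ ξ m).HasTemperateGrowth := by fun_prop
    -- Differentiating `𝓕 φ` along `m` multiplies `φ` by `-2πi ⟨ξ, m⟩`; integration by parts against
    -- `𝓕 φ` cancels the sign.
    set χ : SchwartzMap E ℂ :=
      -(2 * Real.pi * Complex.I) • SchwartzMap.smulLeftCLM ℂ (fun ξ : E => inner ℝ ξ m) φ with hχ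
    have h1 : ∀ x, fderiv ℝ (𝓕 φ : SchwartzMap E ℂ) x m = 𝓕 (χ : E → ℂ) x := fun x => by
      rw [← SchwartzMap.lineDerivOp_apply_eq_fderiv, SchwartzMap.lineDerivOp_fourier_eq,
        ← SchwartzMap.fourier_coe]
    have hF : ∀ θ : SchwartzMap E ℂ, MemLp (θ : E → ℂ) 2 volume := fun θ => θ.memLp 2 volume
    have h2 := integral_mul_fderiv_eq_neg_fderiv_mul_of_integrable (μ := (volume : Measure E))
      (f := h) (g := (𝓕 φ : SchwartzMap E ℂ)) (v := m) (hm.integrable_mul (hF _))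
      (by
        simp only [h1, ← SchwartzMap.fourier_coe]
        exact hh.integrable_mul (hF _))
      (hh.integrable_mul (hF _)) (fun x _ => hd x)
      (fun x _ => (𝓕 φ : SchwartzMap E ℂ).differentiableAt)
    simp only [h1] at h2
    rw [← integral_fourierL2_mul_schwartz hh χ, eq_comm, neg_eq_iff_eq_neg] at h2
    rw [← SchwartzMap.fourier_coe, h2, ← integral_neg]
    congr 1 with ξ
    rw [hχ, smul_apply, SchwartzMap.smulLeftCLM_apply_apply hg]
    simp only [smul_eq_mul, Complex.real_smul]
    ring

end FourierL2

/-! ### Coordinates on the plane -/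

section Plane

theorem measurePreserving_plane :
    MeasurePreserving (fun p : ℝ × ℝ => (!₂[p.1, p.2] : Plane)) volume volume :=
  (PiLp.volume_preserving_toLp (Fin 2)).comp (volume_preserving_finTwoArrow ℝ).symm

@[fun_prop]
theorem measurable_plane {α : Type*} [MeasurableSpace α] {u w : α → ℝ} (hu : Measurable u)
    (hw : Measurable w) : Measurable fun x => (!₂[u x, w x] : Plane) :=
  measurePreserving_plane.measurable.comp (hu.prodMk hw)

theorem plane_eta (ξ : Plane) : !₂[ξ 0, ξ 1] = ξ := by
  ext i; fin_cases i <;> rfl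

theorem inner_plane (ξ η : Plane) : inner ℝ ξ η = ξ 0 * η 0 + ξ 1 * η 1 := by
  simp [PiLp.inner_apply, Fin.sum_univ_two, mul_comm]

theorem lintegral_comp_mul_const {G : ℝ → ℝ≥0∞} (hG : Measurable G) {c : ℝ} (hc : c ≠ 0) :
    ∫⁻ y, G y = ‖c‖ₑ * ∫⁻ v, G (v * c) := by
  conv_lhs => rw [← Real.smul_map_volume_mul_right hc]
  rw [lintegral_smul_measure, lintegral_map hG (by fun_prop), ← Real.enorm_eq_ofReal_abs,
    smul_eq_mul]

theorem lintegral_plane {F : Plane → ℝ≥0∞} (hF : Measurable F) :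
    ∫⁻ ξ, F ξ = ∫⁻ x, ∫⁻ y, F !₂[x, y] := by
  rw [← measurePreserving_plane.lintegral_comp hF, Measure.volume_eq_prod, lintegral_prod]
  exact (hF.comp measurePreserving_plane.measurable).aemeasurable

theorem ae_ne_zero : ∀ᵐ t : ℝ, t ≠ 0 := by
  simp [ae_iff]

/-- Substitution `y = vτ` in the inner integral at fixed `τ ≠ 0`, with Jacobian `|τ|`. -/
theorem lintegral_slope_of_measurable {F : Plane → ℝ≥0∞} (hF : Measurable F) :
    ∫⁻ ξ, F ξ = ∫⁻ v, ∫⁻ τ, ‖τ‖ₑ * F !₂[τ, v * τ] := by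
  rw [lintegral_plane hF]
  symm
  rw [lintegral_lintegral_swap (by fun_prop)]
  symm
  refine lintegral_congr_ae ?_
  filter_upwards [ae_ne_zero] with τ hτ
  rw [lintegral_comp_mul_const (G := fun y => F !₂[τ, y]) (by fun_prop) hτ,
    lintegral_const_mul _ (by fun_prop)]

/-- The coordinates of the plane given by the slope and the first coordinate. -/
def slopeMap (p : ℝ × ℝ) : Plane := !₂[p.2, p.1 * p.2]

@[fun_prop]
theorem measurable_slopeMap : Measurable slopeMap := by
  unfold slopeMap; fun_prop

/-- Lebesgue measure on the plane in slope coordinates. -/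
theorem map_slopeMap :
    Measure.map slopeMap ((volume : Measure (ℝ × ℝ)).withDensity fun p => (‖p.2‖₊ : ℝ≥0∞)) =
      volume := by
  refine Measure.ext_of_lintegral _ fun F hF => ?_
  rw [lintegral_map hF measurable_slopeMap, lintegral_withDensity_eq_lintegral_mul _ (by fun_prop)
    (by fun_prop), Measure.volume_eq_prod, lintegral_prod _ (by fun_prop),
    lintegral_slope_of_measurable hF]
  rfl

/-- The density `|τ|` vanishes only at `τ = 0`, so null sets of the plane are null on almost every
line through the origin. -/
theorem ae_slope {p : Plane → Prop} (h : ∀ᵐ ξ, p ξ) : ∀ᵐ v : ℝ, ∀ᵐ τ : ℝ, p !₂[τ, v * τ] := by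
  rw [← map_slopeMap] at h
  have h1 := ae_of_ae_map measurable_slopeMap.aemeasurable h
  rw [ae_withDensity_iff (by fun_prop)] at h1
  have h2 := Measure.ae_ae_of_ae_prod h1
  filter_upwards [h2] with v hv
  filter_upwards [hv, ae_ne_zero] with τ hτ h0
  exact hτ (by simpa using h0)

theorem lintegral_slope {F : Plane → ℝ≥0∞} (hF : AEMeasurable F) :
    ∫⁻ ξ, F ξ = ∫⁻ v, ∫⁻ τ, ‖τ‖ₑ * F !₂[τ, v * τ] := by
  rw [lintegral_congr_ae hF.ae_eq_mk, lintegral_slope_of_measurable hF.measurable_mk]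
  refine lintegral_congr_ae ?_
  filter_upwards [ae_slope hF.ae_eq_mk] with v hv
  refine lintegral_congr_ae ?_
  filter_upwards [hv] with τ hτ
  rw [hτ]

theorem integrable_slope {F : Plane → ℂ} (hF : Integrable F) :
    Integrable (fun p : ℝ × ℝ => (|p.2| : ℝ) * F !₂[p.2, p.1 * p.2]) (volume.prod volume) := by
  have h1 := hF
  rw [← map_slopeMap] at h1
  have h2 := h1.comp_measurable measurable_slopeMap
  rw [integrable_withDensity_iff_integrable_smul (by fun_prop)] at h2
  exact h2

theorem integral_slope {F : Plane → ℂ} (hF : Integrable F) :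
    ∫ ξ, F ξ = ∫ v, ∫ τ, (|τ| : ℝ) * F !₂[τ, v * τ] := by
  have hm := hF.1
  rw [← map_slopeMap] at hm
  rw [← integral_prod _ (integrable_slope hF)]
  conv_lhs => rw [← map_slopeMap]
  rw [integral_map measurable_slopeMap.aemeasurable hm,
    integral_withDensity_eq_integral_smul (by fun_prop)]
  rfl

theorem integrable_slope_inner {F : Plane → ℂ} (hF : Integrable F) :
    Integrable fun v => ∫ τ, (|τ| : ℝ) * F !₂[τ, v * τ] :=
  (integrable_slope hF).integral_prod_left

end Plane

/-! ### Matrices acting on the plane -/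

section Act

theorem act_mul (M N : Matrix (Fin 2) (Fin 2) ℝ) (x : Plane) : act (M * N) x = act M (act N x) := by
  simp [act, Matrix.toEuclideanLin]

theorem act_apply (M : Matrix (Fin 2) (Fin 2) ℝ) (x : Plane) :
    act M x = !₂[M 0 0 * x 0 + M 0 1 * x 1, M 1 0 * x 0 + M 1 1 * x 1] := by
  ext i
  fin_cases i <;> simp [act, Matrix.toEuclideanLin, Matrix.mulVec, dotProduct, Fin.sum_univ_two]

theorem det_toEuclideanLin (M : Matrix (Fin 2) (Fin 2) ℝ) :
    LinearMap.det (Matrix.toEuclideanLin M) = M.det := by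
  rw [Matrix.toEuclideanLin, Matrix.toLpLin_eq_toLin, LinearMap.det_toLin]

/-- The linear automorphism of the plane given by an invertible matrix. -/
noncomputable def actEquiv (M : Matrix (Fin 2) (Fin 2) ℝ) (hM : M.det ≠ 0) : Plane ≃ₗ[ℝ] Plane :=
  LinearMap.equivOfDetNeZero (Matrix.toEuclideanLin M) (by rwa [det_toEuclideanLin])

theorem actEquiv_apply (M : Matrix (Fin 2) (Fin 2) ℝ) (hM : M.det ≠ 0) (x : Plane) :
    actEquiv M hM x = act M x := rfl

theorem det_actEquiv (M : Matrix (Fin 2) (Fin 2) ℝ) (hM : M.det ≠ 0) :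
    LinearMap.det (actEquiv M hM : Plane →ₗ[ℝ] Plane) = M.det := by
  rw [← det_toEuclideanLin]; rfl

theorem inner_act_transpose (M : Matrix (Fin 2) (Fin 2) ℝ) (ξ x : Plane) :
    inner ℝ (act M.transpose ξ) x = inner ℝ ξ (act M x) := by
  rw [inner_plane, inner_plane, act_apply, act_apply]
  simp
  ring

theorem det_inv_ne_zero {M : Matrix (Fin 2) (Fin 2) ℝ} (hM : M.det ≠ 0) : M⁻¹.det ≠ 0 := by
  rw [Matrix.det_nonsing_inv, Ring.inverse_eq_inv']; exact inv_ne_zero hM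

theorem act_inv_cancel {M : Matrix (Fin 2) (Fin 2) ℝ} (hM : M.det ≠ 0) (x : Plane) :
    act M (act M⁻¹ x) = x := by
  rw [← act_mul, Matrix.mul_nonsing_inv _ (Ne.isUnit hM), act_apply]
  simpa using plane_eta x

theorem fourierL2_comp_act {h : Plane → ℂ} (hh : MemLp h 2 volume)
    {M : Matrix (Fin 2) (Fin 2) ℝ} (hM : M.det ≠ 0) :
    fourierL2 (fun x => h (act M⁻¹ x)) =ᵐ[volume]
      fun ξ => (|M.det| : ℝ) * fourierL2 h (act M.transpose ξ) := by
  have hT : M.transpose.det ≠ 0 := by rwa [Matrix.det_transpose]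
  have := fourierL2_comp_linearEquiv hh (actEquiv M⁻¹ (det_inv_ne_zero hM))
    (actEquiv M.transpose hT) (fun ξ x => ?_) ?_
  · rw [det_actEquiv, Matrix.det_transpose] at this
    exact this
  · rw [actEquiv_apply, actEquiv_apply, inner_act_transpose, act_inv_cancel hM]
  · rw [det_actEquiv, det_actEquiv, Matrix.det_transpose, Matrix.det_nonsing_inv,
      Ring.inverse_eq_inv', inv_inv]

theorem memLp_comp_act {p : ℝ≥0∞} {h : Plane → ℂ} (hh : MemLp h p volume)
    {M : Matrix (Fin 2) (Fin 2) ℝ} (hM : M.det ≠ 0) : MemLp (fun x => h (act M x)) p volume :=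
  memLp_comp_linearEquiv hh (actEquiv M hM)

theorem quasiMeasurePreserving_act {M : Matrix (Fin 2) (Fin 2) ℝ} (hM : M.det ≠ 0) :
    Measure.QuasiMeasurePreserving (act M) volume volume :=
  quasiMeasurePreserving_linearEquiv (actEquiv M hM)

/-- The reflection of the plane exchanging the coordinates. -/
def swapPt (ξ : Plane) : Plane := !₂[ξ 1, ξ 0]

@[simp] theorem swapPt_zero (ξ : Plane) : swapPt ξ 0 = ξ 1 := rfl
@[simp] theorem swapPt_one (ξ : Plane) : swapPt ξ 1 = ξ 0 := rfl
@[simp] theorem swapPt_swapPt (ξ : Plane) : swapPt (swapPt ξ) = ξ := plane_eta ξ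

theorem swapPt_sub (x y : Plane) : swapPt (x - y) = swapPt x - swapPt y := by
  ext i; fin_cases i <;> rfl

theorem act_swap (x : Plane) : act !![0, 1; 1, 0] x = swapPt x := by
  rw [act_apply]; simp [swapPt]

theorem measurePreserving_swapPt : MeasurePreserving swapPt volume volume := by
  have hdet : (!![0, 1; 1, 0] : Matrix (Fin 2) (Fin 2) ℝ).det = -1 := by simp
  have h0 : (!![0, 1; 1, 0] : Matrix (Fin 2) (Fin 2) ℝ).det ≠ 0 := by rw [hdet]; norm_num
  have h1 := map_linearEquiv_volume (actEquiv _ h0)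
  rw [det_actEquiv, hdet] at h1
  have h2 : (⇑(actEquiv _ h0) : Plane → Plane) = swapPt := funext act_swap
  rw [h2] at h1
  refine ⟨?_, by simpa using h1⟩
  unfold swapPt; fun_prop

@[fun_prop]
theorem measurable_swapPt : Measurable swapPt := measurePreserving_swapPt.measurable

theorem measurableEmbedding_swapPt : MeasurableEmbedding swapPt :=
  (MeasurableEquiv.mk ⟨swapPt, swapPt, swapPt_swapPt, swapPt_swapPt⟩ measurable_swapPt
    measurable_swapPt).measurableEmbedding

theorem memLp_comp_swapPt {p : ℝ≥0∞} {h : Plane → ℂ} (hh : MemLp h p volume) :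
    MemLp (fun x => h (swapPt x)) p volume :=
  hh.comp_measurePreserving measurePreserving_swapPt

theorem ae_swapPt {p : Plane → Prop} (h : ∀ᵐ ξ, p ξ) : ∀ᵐ ξ, p (swapPt ξ) :=
  measurePreserving_swapPt.quasiMeasurePreserving.ae h

theorem fourierL2_comp_swapPt {h : Plane → ℂ} (hh : MemLp h 2 volume) :
    fourierL2 (fun x => h (swapPt x)) =ᵐ[volume] fun ξ => fourierL2 h (swapPt ξ) := by
  have hdet : (!![0, 1; 1, 0] : Matrix (Fin 2) (Fin 2) ℝ).det = -1 := by simp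
  have h0 : (!![0, 1; 1, 0] : Matrix (Fin 2) (Fin 2) ℝ).det ≠ 0 := by rw [hdet]; norm_num
  have := fourierL2_comp_act hh h0
  rw [hdet, show (!![0, 1; 1, 0] : Matrix (Fin 2) (Fin 2) ℝ).transpose = !![0, 1; 1, 0] by
    ext i j; fin_cases i <;> fin_cases j <;> rfl,
    show (!![0, 1; 1, 0] : Matrix (Fin 2) (Fin 2) ℝ)⁻¹ = !![0, 1; 1, 0] from
      Matrix.inv_eq_left_inv (by ext i j; fin_cases i <;> fin_cases j <;> simp)] at this
  simpa [act_swap] using this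

end Act

/-! ### The affine Radon transform -/

section Radon

/-- For each `y` the map is a translation in `t`, so it is a measure-preserving skew product. -/
theorem measurePreserving_lines (v : ℝ) :
    MeasurePreserving (fun p : ℝ × ℝ => (!₂[p.1 - v * p.2, p.2] : Plane)) (volume.prod volume)
      volume := by
  have h1 : MeasurePreserving (fun q : ℝ × ℝ => (q.1, q.2 - v * q.1)) (volume.prod volume)
      (volume.prod volume) :=
    (MeasurePreserving.id volume).skew_product (g := fun y t => t - v * y) (by fun_prop)
      (Filter.Eventually.of_forall fun y => (measurePreserving_sub_right volume (v * y)).map_eq)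
  exact (measurePreserving_plane.comp Measure.measurePreserving_swap).comp
    (h1.comp Measure.measurePreserving_swap)

theorem integrable_lines {f : Plane → ℂ} (hf : Integrable f) (v : ℝ) :
    Integrable (fun p : ℝ × ℝ => f !₂[p.1 - v * p.2, p.2]) (volume.prod volume) :=
  (measurePreserving_lines v).integrable_comp_of_integrable hf

theorem integrable_radonH {f : Plane → ℂ} (hf : Integrable f) (v : ℝ) :
    Integrable (radonH f v) :=
  (integrable_lines hf v).integral_prod_left

theorem integral_lines {F : Plane → ℂ} (hF : AEStronglyMeasurable F) (v : ℝ) :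
    ∫ x, F x = ∫ p : ℝ × ℝ, F !₂[p.1 - v * p.2, p.2] ∂(volume.prod volume) := by
  have hm := hF
  rw [← (measurePreserving_lines v).map_eq] at hm
  conv_lhs => rw [← (measurePreserving_lines v).map_eq]
  exact integral_map (measurePreserving_lines v).measurable.aemeasurable hm

/-- The Fourier slice theorem. -/
theorem fourier_radonH {f : Plane → ℂ} (hf : Integrable f) (v τ : ℝ) :
    𝓕 (radonH f v) τ = 𝓕 f !₂[τ, v * τ] := by
  have hchar : Continuous fun x : Plane => expI (-(inner ℝ x (!₂[τ, v * τ] : Plane))) :=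
    continuous_expI.comp (by fun_prop)
  have hint : Integrable fun x => expI (-(inner ℝ x (!₂[τ, v * τ] : Plane))) * f x :=
    (integrable_norm_iff (hchar.aestronglyMeasurable.mul hf.1)).1 (by simpa using hf.norm)
  -- On the line with parameters `(v, t)` the phase `(t - vy)τ + y(vτ)` equals `tτ`, independently
  -- of `y`; the `y`-integral is therefore `ℛf(v, t)`.
  rw [fourier_eq_expI, fourier_eq_expI, integral_lines hint.1 v,
    integral_prod _ (integrable_lines hint v)]
  refine integral_congr_ae (Filter.Eventually.of_forall fun t => ?_)
  simp only [radonH]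
  rw [← integral_const_mul]
  congr 1 with y
  rw [inner_plane]
  congr 3
  simp
  ring

theorem memLp_two_iff {E : Type*} [MeasureSpace E] {h : E → ℂ} :
    MemLp h 2 volume ↔ AEStronglyMeasurable h ∧ ∫⁻ x, ‖h x‖ₑ ^ 2 < ⊤ := by
  have := eLpNorm_nnreal_pow_eq_lintegral (f := h) (μ := (volume : Measure E)) (p := 2)
    (by norm_num)
  have h2 : eLpNorm h 2 volume ^ 2 = ∫⁻ x, ‖h x‖ₑ ^ 2 := by simpa using this
  rw [MemLp, ← h2]
  simp

theorem memLp_fourier {f : Plane → ℂ} (hf₁ : Integrable f) (hf₂ : MemLp f 2 volume) :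
    MemLp (𝓕 f) 2 volume :=
  (memLp_congr_ae (fourierL2_ae_eq_fourier hf₁ hf₂)).1 (memLp_fourierL2 f)

/-- In slope coordinates `∫ |ℱf|²` is an integral over `v` of these quantities; being finite, it has
almost everywhere finite integrand. -/
theorem ae_lintegral_slice {f : Plane → ℂ} (hf₁ : Integrable f) (hf₂ : MemLp f 2 volume) :
    ∀ᵐ v : ℝ, ∫⁻ τ, ‖τ‖ₑ * ‖𝓕 (radonH f v) τ‖ₑ ^ 2 < ⊤ := by
  have hc : Continuous (𝓕 f) := continuous_fourier hf₁
  have hm : Measurable fun ξ => ‖𝓕 f ξ‖ₑ ^ 2 := by fun_prop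
  have h1 := (memLp_two_iff.1 (memLp_fourier hf₁ hf₂)).2
  rw [lintegral_slope hm.aemeasurable] at h1
  simp only [fourier_radonH hf₁]
  refine ae_lt_top (Measurable.lintegral_prod_right' (ν := volume)
    (f := fun p : ℝ × ℝ => ‖p.2‖ₑ * ‖𝓕 f !₂[p.2, p.1 * p.2]‖ₑ ^ 2) ?_) h1.ne
  exact Measurable.mul (by fun_prop) (hm.comp measurable_slopeMap)

/-- The weight `|τ|` is harmless for `|τ| ≥ 1`; near the origin, where it degenerates, the transform
of an integrable function is bounded. -/
theorem memLp_fourier_slice {h : ℝ → ℂ} (hh : Integrable h)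
    (hfin : ∫⁻ τ, ‖τ‖ₑ * ‖𝓕 h τ‖ₑ ^ 2 < ⊤) : MemLp (𝓕 h) 2 volume := by
  have hc : Continuous (𝓕 h) := continuous_fourier hh
  refine memLp_two_iff.2 ⟨hc.aestronglyMeasurable, ?_⟩
  set C : ℝ≥0∞ := ENNReal.ofReal (∫ x, ‖h x‖)
  have hb : ∀ τ, ‖𝓕 h τ‖ₑ ≤ C := fun τ => by
    rw [← ofReal_norm]; exact ENNReal.ofReal_le_ofReal (norm_fourier_le h τ)
  calc ∫⁻ τ, ‖𝓕 h τ‖ₑ ^ 2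
      ≤ ∫⁻ τ, ((Set.Icc (-1 : ℝ) 1).indicator (fun _ => C ^ 2) τ + ‖τ‖ₑ * ‖𝓕 h τ‖ₑ ^ 2) := by
        refine lintegral_mono fun τ => ?_
        by_cases hτ : τ ∈ Set.Icc (-1 : ℝ) 1
        · rw [Set.indicator_of_mem hτ]
          exact le_add_right (pow_le_pow_left' (hb τ) 2)
        · rw [Set.indicator_of_notMem hτ, zero_add]
          refine le_mul_of_one_le_left' ?_
          have : 1 ≤ |τ| := by
            by_contra hlt
            exact hτ (abs_le.1 (not_le.1 hlt).le)
          rw [Real.enorm_eq_ofReal_abs]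
          simpa using this
    _ = (∫⁻ τ, (Set.Icc (-1 : ℝ) 1).indicator (fun _ => C ^ 2) τ)
          + ∫⁻ τ, ‖τ‖ₑ * ‖𝓕 h τ‖ₑ ^ 2 :=
        lintegral_add_left (measurable_const.indicator measurableSet_Icc) _
    _ < ⊤ := by
        refine ENNReal.add_lt_top.2 ⟨?_, hfin⟩
        rw [lintegral_indicator measurableSet_Icc, setLIntegral_const]
        exact ENNReal.mul_lt_top (ENNReal.pow_lt_top ENNReal.ofReal_lt_top) (by simp)

theorem ae_memLp_radonH {f : Plane → ℂ} (hf₁ : Integrable f) (hf₂ : MemLp f 2 volume) :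
    ∀ᵐ v : ℝ, MemLp (radonH f v) 2 volume := by
  filter_upwards [ae_lintegral_slice hf₁ hf₂] with v hv
  have h1 := integrable_radonH hf₁ v
  exact memLp_two_of_fourier h1 (memLp_fourier_slice h1 hv)

theorem radonV_eq_radonH (f : Plane → ℂ) : radonV f = radonH fun x => f (swapPt x) := rfl

theorem fourierL2_radonH {f : Plane → ℂ} (hf₁ : Integrable f) {v : ℝ}
    (hv : MemLp (radonH f v) 2 volume) :
    fourierL2 (radonH f v) =ᵐ[volume] fun τ => 𝓕 f !₂[τ, v * τ] := by
  filter_upwards [fourierL2_ae_eq_fourier (integrable_radonH hf₁ v) hv] with τ hτ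
  rw [hτ, fourier_radonH hf₁]

end Radon

/-! ### The operator `J₀` and the window coefficients -/

section Window

theorem memLp_J0 (h : ℝ → ℂ) : MemLp (J0 h) 2 volume := memLp_fourierInvL2 _

theorem fourierL2_J0 {h : ℝ → ℂ} (hh : MemDomJ0 h) :
    fourierL2 (J0 h) =ᵐ[volume] fun τ => ((|τ| ^ (1 / 2 : ℝ) : ℝ) : ℂ) * fourierL2 h τ :=
  fourierL2_fourierInvL2 hh.2

theorem abs_rpow_half_mul_self (τ : ℝ) : |τ| ^ (1 / 2 : ℝ) * |τ| ^ (1 / 2 : ℝ) = |τ| := by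
  rw [← Real.sqrt_eq_rpow, Real.mul_self_sqrt (abs_nonneg τ)]

theorem fourierL2_J0_ae_mul {h : ℝ → ℂ} (hh : MemDomJ0 h) :
    (fun τ : ℝ => ((|τ| ^ (1 / 2 : ℝ) : ℝ) : ℂ) * fourierL2 (J0 h) τ) =ᵐ[volume]
      fun τ => ((|τ| : ℝ) : ℂ) * fourierL2 h τ := by
  filter_upwards [fourierL2_J0 hh] with τ hτ
  rw [hτ, ← mul_assoc, ← Complex.ofReal_mul, abs_rpow_half_mul_self]

theorem fourierL2_J0_J0 {h : ℝ → ℂ} (hh : MemDomJ0 h) (hh' : MemDomJ0 (J0 h)) :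
    fourierL2 (J0 (J0 h)) =ᵐ[volume] fun τ => ((|τ| : ℝ) : ℂ) * fourierL2 h τ :=
  (fourierL2_J0 hh').trans (fourierL2_J0_ae_mul hh)

theorem memDomJ0_J0_of_memLp {h : ℝ → ℂ} (hh : MemDomJ0 h)
    (h2 : MemLp (fun τ : ℝ => ((|τ| : ℝ) : ℂ) * fourierL2 h τ) 2 volume) : MemDomJ0 (J0 h) :=
  ⟨memLp_fourierInvL2 _, (memLp_congr_ae (fourierL2_J0_ae_mul hh)).2 h2⟩

/-- The scalar product with a translate, on the Fourier side. -/
theorem ip_translateBy {E : Type*} [NormedAddCommGroup E] [InnerProductSpace ℝ E]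
    [FiniteDimensional ℝ E] [MeasurableSpace E] [BorelSpace E] {u w : E → ℂ}
    (hu : MemLp u 2 volume) (hw : MemLp w 2 volume) (b : E) :
    ip u (translateBy b w) = ∫ ξ, expI (inner ℝ b ξ) * (fourierL2 u ξ * star (fourierL2 w ξ)) := by
  rw [ip_eq_integral_fourierL2 hu (memLp_translateBy hw b)]
  refine integral_congr_ae ?_
  filter_upwards [fourierL2_translateBy hw b] with ξ hξ
  rw [hξ, star_mul', star_expI, neg_neg]
  ring

theorem integrable_expI_mul {E : Type*} [NormedAddCommGroup E] [InnerProductSpace ℝ E]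
    [FiniteDimensional ℝ E] [MeasurableSpace E] [BorelSpace E] {F : E → ℂ}
    (hF : Integrable F) (b : E) : Integrable fun ξ => expI (inner ℝ b ξ) * F ξ := by
  have := memLp_expI_mul (memLp_one_iff_integrable.2 hF) (-b)
  simpa using memLp_one_iff_integrable.1 this

theorem window_coefficients {f g : Plane → ℂ} (hf₁ : Integrable f) (hf₂ : MemLp f 2 volume)
    (hg₁ : Integrable g) (hg₂ : MemLp g 2 volume)
    (hdom : ∀ᵐ v : ℝ, MemDomJ0 (radonH g v) ∧ MemDomJ0 (J0 (radonH g v))) (x y : ℝ) :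
    Integrable (fun v : ℝ =>
        ip (radonH f v) (translateBy (x + v * y) (J0 (J0 (radonH g v))))) volume ∧
      ip f (translateBy !₂[x, y] g) =
        ∫ v : ℝ, ip (radonH f v) (translateBy (x + v * y) (J0 (J0 (radonH g v)))) := by
  set F : Plane → ℂ := fun ξ => expI (inner ℝ (!₂[x, y] : Plane) ξ) *
    (fourierL2 f ξ * star (fourierL2 g ξ)) with hFdef
  have hF : Integrable F := integrable_expI_mul (integrable_mul_star_fourierL2 f g) _
  -- The Jacobian `|τ|` is exactly the symbol of `J₀²`, and the phase `xτ + yvτ` is that of a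
  -- translation by `x + vy`.
  have key : ∀ᵐ v : ℝ, ∫ τ, (|τ| : ℝ) * F !₂[τ, v * τ] =
      ip (radonH f v) (translateBy (x + v * y) (J0 (J0 (radonH g v)))) := by
    filter_upwards [hdom, ae_memLp_radonH hf₁ hf₂, ae_slope (fourierL2_ae_eq_fourier hf₁ hf₂),
      ae_slope (fourierL2_ae_eq_fourier hg₁ hg₂)] with v hv hfv hfs hgs
    rw [ip_translateBy hfv (memLp_J0 _)]
    refine integral_congr_ae ?_
    filter_upwards [hfs, hgs, fourierL2_radonH hf₁ hfv, fourierL2_radonH hg₁ hv.1.1,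
      fourierL2_J0_J0 hv.1 hv.2] with τ h1 h2 h3 h4 h5
    rw [hFdef]
    simp only
    rw [h1, h2, h3, h5, h4, inner_plane, star_mul']
    have e : (!₂[x, y] : Plane) 0 * (!₂[τ, v * τ] : Plane) 0 +
        (!₂[x, y] : Plane) 1 * (!₂[τ, v * τ] : Plane) 1 = inner ℝ (x + v * y) τ := by
      simp; ring
    rw [e]
    simp only [RCLike.star_def, Complex.conj_ofReal]
    ring
  refine ⟨(integrable_slope_inner hF).congr key, ?_⟩
  rw [ip_translateBy hf₂ hg₂, ← integral_congr_ae key, ← integral_slope hF]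

end Window

/-! ### Wavelet and shearlet transforms on the Fourier side -/

section Transforms

theorem star_ofReal_mul (c : ℝ) (z : ℂ) : star ((c : ℂ) * z) = c * star z := by
  rw [star_mul', RCLike.star_def, Complex.conj_ofReal]

theorem enorm_ofReal (r : ℝ) : ‖(r : ℂ)‖ₑ = ‖r‖ₑ := by
  rw [← ofReal_norm, ← ofReal_norm, Complex.norm_real]

theorem ip_const_mul_right {E : Type*} [MeasureSpace E] (u w : E → ℂ) (c : ℝ) :
    ip u (fun x => (c : ℂ) * w x) = (c : ℂ) * ip u w := by
  rw [ip, ip, ← integral_const_mul]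
  congr 1 with x
  rw [star_ofReal_mul]
  ring

theorem ip_congr {E : Type*} [MeasureSpace E] {u u' w w' : E → ℂ} (hu : u =ᵐ[volume] u')
    (hw : w =ᵐ[volume] w') : ip u w = ip u' w' := by
  refine integral_congr_ae ?_
  filter_upwards [hu, hw] with x h1 h2
  rw [h1, h2]

/-- Multiplication by a nonzero real number. -/
noncomputable def scaleEquiv (c : ℝ) (hc : c ≠ 0) : ℝ ≃ₗ[ℝ] ℝ :=
  LinearEquiv.smulOfNeZero ℝ ℝ c hc

theorem det_scaleEquiv (c : ℝ) (hc : c ≠ 0) :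
    LinearMap.det (scaleEquiv c hc : ℝ →ₗ[ℝ] ℝ) = c := by
  have : (scaleEquiv c hc : ℝ →ₗ[ℝ] ℝ) = c • LinearMap.id := by
    ext; simp [scaleEquiv]
  rw [this, LinearMap.det_smul]
  simp

theorem memLp_comp_div {p : ℝ≥0∞} {h : ℝ → ℂ} (hh : MemLp h p volume) {a : ℝ} (ha : a ≠ 0) :
    MemLp (fun x => h (x / a)) p volume := by
  have := memLp_comp_linearEquiv hh (scaleEquiv a⁻¹ (inv_ne_zero ha))
  simpa only [scaleEquiv, LinearEquiv.smulOfNeZero_apply, smul_eq_mul, inv_mul_eq_div] using this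

theorem fourierL2_comp_div {h : ℝ → ℂ} (hh : MemLp h 2 volume) {a : ℝ} (ha : a ≠ 0) :
    fourierL2 (fun x => h (x / a)) =ᵐ[volume] fun τ => (|a| : ℝ) * fourierL2 h (a * τ) := by
  have := fourierL2_comp_linearEquiv hh (scaleEquiv a⁻¹ (inv_ne_zero ha)) (scaleEquiv a ha)
    (fun ξ x => by simp [scaleEquiv]; field_simp) (by simp only [det_scaleEquiv, inv_inv])
  rw [det_scaleEquiv] at this
  simpa only [scaleEquiv, LinearEquiv.smulOfNeZero_apply, smul_eq_mul, inv_mul_eq_div] using this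

theorem ae_comp_mul {p : ℝ → Prop} (h : ∀ᵐ τ, p τ) {a : ℝ} (ha : a ≠ 0) : ∀ᵐ τ, p (a * τ) :=
  (quasiMeasurePreserving_linearEquiv (scaleEquiv a ha)).ae h

theorem waveletTransform_eq {χ h : ℝ → ℂ} (hχ : MemLp χ 2 volume) (hh : MemLp h 2 volume)
    (b : ℝ) {a : ℝ} (ha : a ≠ 0) :
    waveletTransform χ h b a = ((|a| ^ (1 / 2 : ℝ) : ℝ) : ℂ) *
      ∫ τ, expI (b * τ) * (fourierL2 h τ * star (fourierL2 χ (a * τ))) := by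
  have h1 : waveletRep b a χ = fun x => ((|a| ^ (-(1 / 2 : ℝ)) : ℝ) : ℂ) *
    translateBy b (fun x => χ (x / a)) x := rfl
  have ha' : 0 < |a| := abs_pos.2 ha
  rw [waveletTransform, h1, ip_const_mul_right, ip_translateBy hh (memLp_comp_div hχ ha)]
  -- Normalisation `|a|^{-1/2}` times the factor `|a|` from the transform of a dilate.
  have h2 : |a| ^ (1 / 2 : ℝ) = |a| ^ (-(1 / 2 : ℝ)) * |a| := by
    conv_rhs => rw [← Real.rpow_add_one ha'.ne']
    norm_num
  rw [h2, Complex.ofReal_mul, mul_assoc]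
  congr 1
  rw [← integral_const_mul]
  refine integral_congr_ae ?_
  filter_upwards [fourierL2_comp_div hχ ha] with τ hτ
  rw [hτ, star_ofReal_mul]
  simp only [RCLike.inner_apply, conj_trivial]
  rw [mul_comm τ b]
  ring

theorem memLp_abs_mul_fourierL2 {ψ₁ : ℝ → ℂ}
    (h : ∫⁻ τ : ℝ, ‖τ‖ₑ ^ 2 * ‖fourierL2 ψ₁ τ‖ₑ ^ 2 < ⊤) :
    MemLp (fun τ : ℝ => ((|τ| : ℝ) : ℂ) * fourierL2 ψ₁ τ) 2 volume := by
  refine memLp_two_iff.2 ⟨?_, ?_⟩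
  · exact Continuous.aestronglyMeasurable (by fun_prop) |>.mul
      (stronglyMeasurable_fourierL2 ψ₁).aestronglyMeasurable
  · refine lt_of_eq_of_lt (lintegral_congr fun τ => ?_) h
    rw [enorm_mul, mul_pow, enorm_ofReal, Real.enorm_abs]

theorem memLp_chiOne (ψ₁ : ℝ → ℂ) : MemLp (chiOne ψ₁) 2 volume := memLp_fourierInvL2 _

/-- Since `ℱχ₁(aτ) = |a| |τ| ℱψ₁(aτ)`, the wavelet `χ₁` supplies the Jacobian `|τ|` of slope
coordinates and one more power of `|a|`. -/
theorem waveletTransform_chiOne {ψ₁ h : ℝ → ℂ}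
    (h₁ : ∫⁻ τ : ℝ, ‖τ‖ₑ ^ 2 * ‖fourierL2 ψ₁ τ‖ₑ ^ 2 < ⊤) (hh : MemLp h 2 volume)
    (b : ℝ) {a : ℝ} (ha : a ≠ 0) :
    waveletTransform (chiOne ψ₁) h b a = ((|a| ^ (3 / 2 : ℝ) : ℝ) : ℂ) *
      ∫ τ, (|τ| : ℝ) * (expI (b * τ) * (fourierL2 h τ * star (fourierL2 ψ₁ (a * τ)))) := by
  have ha' : 0 < |a| := abs_pos.2 ha
  rw [waveletTransform_eq (memLp_chiOne _) hh b ha]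
  have h2 : |a| ^ (3 / 2 : ℝ) = |a| ^ (1 / 2 : ℝ) * |a| := by
    conv_rhs => rw [← Real.rpow_add_one ha'.ne']
    norm_num
  rw [h2, Complex.ofReal_mul, mul_assoc]
  congr 1
  rw [← integral_const_mul]
  refine integral_congr_ae ?_
  filter_upwards [ae_comp_mul (fourierL2_fourierInvL2 (memLp_abs_mul_fourierL2 h₁)) ha] with τ hτ
  rw [abs_mul] at hτ
  rw [chiOne, hτ, star_ofReal_mul,
    Complex.ofReal_mul]
  ring

theorem measurableSet_coneH : MeasurableSet coneH :=
  measurableSet_le (by fun_prop) (by fun_prop)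

theorem measurableSet_coneV : MeasurableSet coneV :=
  measurableSet_le (by fun_prop) (by fun_prop)

theorem memLp_freqProj (D : Set Plane) (f : Plane → ℂ) : MemLp (freqProj D f) 2 volume :=
  memLp_fourierInvL2 _

theorem fourierL2_freqProj {D : Set Plane} (hD : MeasurableSet D) (f : Plane → ℂ) :
    fourierL2 (freqProj D f) =ᵐ[volume] D.indicator (fourierL2 f) :=
  fourierL2_fourierInvL2 ((memLp_fourierL2 f).indicator hD)

theorem det_shear_mul_dil (s : ℝ) {a : ℝ} (ha : a ≠ 0) :
    |(shear s * dil a).det| = |a| ^ (3 / 2 : ℝ) := by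
  have ha' : 0 < |a| := abs_pos.2 ha
  rw [Matrix.det_mul]
  simp only [shear, dil, Matrix.det_fin_two_of, Matrix.det_smul, Fintype.card_fin]
  rw [abs_mul, abs_mul, abs_pow]
  simp only [mul_one, mul_zero, sub_zero, abs_one, one_mul]
  rw [abs_of_pos (Real.rpow_pos_of_pos ha' _), ← Real.rpow_natCast, ← Real.rpow_add ha']
  norm_num

theorem det_shear_mul_dil_ne_zero (s : ℝ) {a : ℝ} (ha : a ≠ 0) : (shear s * dil a).det ≠ 0 := by
  rw [← abs_pos, det_shear_mul_dil s ha]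
  exact Real.rpow_pos_of_pos (abs_pos.2 ha) _

/-- The action of dilations and shears on frequencies. -/
theorem act_dil_shear (a s : ℝ) (ξ : Plane) : act (dil a) (act (shear s).transpose ξ) =
    !₂[a * ξ 0, a * |a| ^ (-(1 / 2 : ℝ)) * (ξ 1 - s * ξ 0)] := by
  rw [act_apply, act_apply]
  ext i; fin_cases i <;> simp [dil, shear]
  ring_nf; simp

theorem act_transpose_shear_mul_dil (s a : ℝ) (ξ : Plane) :
    act (shear s * dil a).transpose ξ = act (dil a) (act (shear s).transpose ξ) := by
  rw [Matrix.transpose_mul, act_mul]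
  congr 1
  ext i j; fin_cases i <;> fin_cases j <;> simp [dil]

/-- The frequency content of the shearlet coefficients of `P_C f`. -/
noncomputable def shearletSpectrum (ψ f : Plane → ℂ) (s a : ℝ) (ξ : Plane) : ℂ :=
  ((|a| ^ (3 / 4 : ℝ) : ℝ) : ℂ) * (coneH.indicator (fourierL2 f) ξ *
    star (fourierL2 ψ (act (dil a) (act (shear s).transpose ξ))))

theorem memLp_fourierL2_comp (ψ : Plane → ℂ) (s : ℝ) {a : ℝ} (ha : a ≠ 0) :
    MemLp (fun ξ => fourierL2 ψ (act (dil a) (act (shear s).transpose ξ))) 2 volume := by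
  simp only [← act_transpose_shear_mul_dil]
  exact memLp_comp_act (memLp_fourierL2 ψ)
    (by rw [Matrix.det_transpose]; exact det_shear_mul_dil_ne_zero s ha)

theorem integrable_shearletSpectrum (ψ f : Plane → ℂ) (s : ℝ) {a : ℝ} (ha : a ≠ 0) :
    Integrable (shearletSpectrum ψ f s a) :=
  ((memLp_fourierL2 f).indicator measurableSet_coneH |>.integrable_mul
    (memLp_fourierL2_comp ψ s ha).star).const_mul _

theorem shearletTransform_eq {ψ : Plane → ℂ} (hψ : MemLp ψ 2 volume) (f : Plane → ℂ) (b : Plane)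
    (s : ℝ) {a : ℝ} (ha : a ≠ 0) :
    shearletTransform ψ (freqProj coneH f) b s a =
      ∫ ξ, expI (inner ℝ b ξ) * shearletSpectrum ψ f s a ξ := by
  have ha' : 0 < |a| := abs_pos.2 ha
  have h0 := det_shear_mul_dil_ne_zero s ha
  have h1 : shearletRep b s a ψ = fun x => ((|a| ^ (-(3 / 4 : ℝ)) : ℝ) : ℂ) *
      translateBy b (fun x => ψ (act (shear s * dil a)⁻¹ x)) x := by
    funext x
    rw [translateBy, Matrix.mul_inv_rev, act_mul]; rfl
  -- Normalisation `|a|^{-3/4}` times the determinant `|a|^{3/2}` of `shear s * dil a`.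
  have h2 : |a| ^ (3 / 4 : ℝ) = |a| ^ (-(3 / 4 : ℝ)) * |a| ^ (3 / 2 : ℝ) := by
    rw [← Real.rpow_add ha']; norm_num
  rw [shearletTransform, h1, ip_const_mul_right, ip_translateBy (memLp_freqProj _ _)
    (memLp_comp_act hψ (det_inv_ne_zero h0)), ← integral_const_mul]
  refine integral_congr_ae ?_
  filter_upwards [fourierL2_comp_act hψ h0, fourierL2_freqProj measurableSet_coneH f] with ξ h3 h4
  rw [h3, h4, shearletSpectrum, h2, det_shear_mul_dil s ha, star_ofReal_mul, act_transpose_shear_mul_dil]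
  push_cast
  ring

theorem slope_mem_coneH {v τ : ℝ} (hτ : τ ≠ 0) :
    (!₂[τ, v * τ] : Plane) ∈ coneH ↔ v ∈ Set.Icc (-1 : ℝ) 1 := by
  have : (!₂[τ, v * τ] : Plane) ∈ coneH ↔ |v * τ| ≤ |τ| := Iff.rfl
  rw [this, abs_mul, Set.mem_Icc, ← abs_le]
  exact mul_le_iff_le_one_left (abs_pos.2 hτ)

theorem ae_comp_dil_shear {p : Plane → Prop} (h : ∀ᵐ ξ, p ξ) (s : ℝ) {a : ℝ} (ha : a ≠ 0) :
    ∀ᵐ ξ, p (act (dil a) (act (shear s).transpose ξ)) := by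
  simp only [← act_transpose_shear_mul_dil]
  exact (quasiMeasurePreserving_act
    (by rw [Matrix.det_transpose]; exact det_shear_mul_dil_ne_zero s ha)).ae h

/-- The radial variable cancels, so the second factor of `ℱψ` depends on the slope alone and leaves
the `τ`-integral. -/
theorem slope_dil_shear {a τ : ℝ} (ha : a ≠ 0) (hτ : τ ≠ 0) (s v : ℝ) :
    a * |a| ^ (-(1 / 2 : ℝ)) * (v * τ - s * τ) / (a * τ) = (v - s) / |a| ^ (1 / 2 : ℝ) := by
  rw [Real.rpow_neg (abs_nonneg a)]
  have := (Real.rpow_pos_of_pos (abs_pos.2 ha) (1 / 2)).ne'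
  field_simp

theorem shearlet_coefficients {ψ : Plane → ℂ} {ψ₁ ψ₂ : ℝ → ℂ} (hψ : MemLp ψ 2 volume)
    (hprod : ∀ᵐ ξ : Plane, fourierL2 ψ ξ = fourierL2 ψ₁ (ξ 0) * fourierL2 ψ₂ (ξ 1 / ξ 0))
    (hψ₁_two : ∫⁻ τ : ℝ, ‖τ‖ₑ ^ 2 * ‖fourierL2 ψ₁ τ‖ₑ ^ 2 < ⊤)
    {f : Plane → ℂ} (hf₁ : Integrable f) (hf₂ : MemLp f 2 volume) (x y s : ℝ) {a : ℝ}
    (ha : a ≠ 0) :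
    IntervalIntegrable (fun v : ℝ =>
        waveletTransform (chiOne ψ₁) (radonH f v) (x + v * y) a
          * star (fourierL2 ψ₂ ((v - s) / |a| ^ (1 / 2 : ℝ)))) volume (-1) 1 ∧
    shearletTransform ψ (freqProj coneH f) !₂[x, y] s a =
      ((|a| ^ (-(3 / 4 : ℝ)) : ℝ) : ℂ) * ∫ v in (-1 : ℝ)..1,
        waveletTransform (chiOne ψ₁) (radonH f v) (x + v * y) a
          * star (fourierL2 ψ₂ ((v - s) / |a| ^ (1 / 2 : ℝ))) := by
  have ha' : 0 < |a| := abs_pos.2 ha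
  set H : ℝ → ℂ := fun v => waveletTransform (chiOne ψ₁) (radonH f v) (x + v * y) a
          * star (fourierL2 ψ₂ ((v - s) / |a| ^ (1 / 2 : ℝ))) with hH
  set F : Plane → ℂ := fun ξ => expI (inner ℝ (!₂[x, y] : Plane) ξ) * shearletSpectrum ψ f s a ξ
    with hFdef
  have hF : Integrable F := integrable_expI_mul (integrable_shearletSpectrum ψ f s ha) _
  set c : ℂ := ((|a| ^ (-(3 / 4 : ℝ)) : ℝ) : ℂ) with hc
  have hc0 : c ≠ 0 := Complex.ofReal_ne_zero.2 (Real.rpow_pos_of_pos ha' _).ne'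
  have h34 : c * ((|a| ^ (3 / 2 : ℝ) : ℝ) : ℂ) = ((|a| ^ (3 / 4 : ℝ) : ℝ) : ℂ) := by
    rw [hc, ← Complex.ofReal_mul, ← Real.rpow_add ha']; norm_num
  have key : ∀ᵐ v : ℝ, ∫ τ, (|τ| : ℝ) * F !₂[τ, v * τ] =
      (Set.Icc (-1 : ℝ) 1).indicator (fun v => c * H v) v := by
    -- On slopes `|v| ≤ 1` the whole line lies in the cone and the integral is a wavelet
    -- coefficient; on other slopes the spectrum vanishes off `τ = 0`.
    filter_upwards [ae_memLp_radonH hf₁ hf₂, ae_slope (fourierL2_ae_eq_fourier hf₁ hf₂),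
      ae_slope (ae_comp_dil_shear hprod s ha)] with v hfv hfs hps
    by_cases hv : v ∈ Set.Icc (-1 : ℝ) 1
    · rw [Set.indicator_of_mem hv, hH]
      simp only
      rw [waveletTransform_chiOne hψ₁_two hfv _ ha, ← mul_assoc, ← mul_assoc, h34, mul_assoc,
        ← integral_mul_const, ← integral_const_mul]
      refine integral_congr_ae ?_
      filter_upwards [hfs, hps, fourierL2_radonH hf₁ hfv, ae_ne_zero] with τ h1 h2 h3 h4
      simp only [hFdef, shearletSpectrum]
      rw [Set.indicator_of_mem ((slope_mem_coneH h4).2 hv), h1, h2, h3, act_dil_shear, inner_plane,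
        star_mul']
      have e : (!₂[x, y] : Plane) 0 * (!₂[τ, v * τ] : Plane) 0 +
          (!₂[x, y] : Plane) 1 * (!₂[τ, v * τ] : Plane) 1 = (x + v * y) * τ := by
        simp; ring
      rw [e]
      have e2 := slope_dil_shear ha h4 s v
      simp only [Matrix.cons_val_zero, Matrix.cons_val_one]
      rw [e2]
      ring
    · rw [Set.indicator_of_notMem hv]
      refine integral_eq_zero_of_ae ?_
      filter_upwards [ae_ne_zero] with τ h4
      simp only [hFdef, shearletSpectrum]
      rw [Set.indicator_of_notMem (fun hm => hv ((slope_mem_coneH h4).1 hm))]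
      simp
  have hint := (integrable_slope_inner hF).congr key
  rw [integrable_indicator_iff measurableSet_Icc] at hint
  have hint2 : IntegrableOn H (Set.Icc (-1) 1) := by
    have := hint.const_mul c⁻¹
    simp only [← mul_assoc, inv_mul_cancel₀ hc0, one_mul] at this
    exact this
  refine ⟨(intervalIntegrable_iff_integrableOn_Icc_of_le (by norm_num)).2 hint2, ?_⟩
  rw [shearletTransform_eq hψ f _ s ha, integral_slope hF, integral_congr_ae key,
    integral_indicator measurableSet_Icc, integral_const_mul,
    intervalIntegral.integral_of_le (by norm_num), integral_Icc_eq_integral_Ioc]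

end Transforms

/-! ### Exchanging the two coordinates -/

section Swap

theorem fourierL2_swapped (ψ : Plane → ℂ) :
    fourierL2 (swapped ψ) =ᵐ[volume] fun ξ => fourierL2 ψ (swapPt ξ) :=
  fourierL2_fourierInvL2 (memLp_comp_swapPt (memLp_fourierL2 ψ))

theorem ae_eq_of_fourierL2_ae_eq {u w : Plane → ℂ} (hu : MemLp u 2 volume) (hw : MemLp w 2 volume)
    (h : fourierL2 u =ᵐ[volume] fourierL2 w) : u =ᵐ[volume] w :=
  (fourierInvL2_fourierL2 hu).symm.trans
    ((fourierInvL2_congr h).symm ▸ fourierInvL2_fourierL2 hw)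

theorem swapped_ae_eq {ψ : Plane → ℂ} (hψ : MemLp ψ 2 volume) :
    swapped ψ =ᵐ[volume] fun x => ψ (swapPt x) :=
  ae_eq_of_fourierL2_ae_eq (memLp_fourierInvL2 _) (memLp_comp_swapPt hψ)
    ((fourierL2_swapped ψ).trans (fourierL2_comp_swapPt hψ).symm)

theorem swapPt_mem_coneH (ξ : Plane) : swapPt ξ ∈ coneH ↔ ξ ∈ coneV := Iff.rfl

theorem freqProj_coneV_ae_eq {f : Plane → ℂ} (hf : MemLp f 2 volume) :
    freqProj coneV f =ᵐ[volume]
      fun x => freqProj coneH (fun x => f (swapPt x)) (swapPt x) := by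
  refine ae_eq_of_fourierL2_ae_eq (memLp_fourierInvL2 _)
    (memLp_comp_swapPt (memLp_fourierInvL2 _)) ?_
  filter_upwards [fourierL2_freqProj measurableSet_coneV f,
    fourierL2_comp_swapPt (memLp_fourierInvL2 (coneH.indicator
      (fourierL2 fun x => f (swapPt x)))),
    ae_swapPt (fourierL2_freqProj measurableSet_coneH fun x => f (swapPt x)),
    ae_swapPt (fourierL2_comp_swapPt hf)] with ξ h1 h2 h3 h4
  rw [freqProj] at h3
  unfold freqProj at h1 ⊢
  rw [h1, h2, h3]
  by_cases hξ : ξ ∈ coneV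
  · rw [Set.indicator_of_mem hξ, Set.indicator_of_mem ((swapPt_mem_coneH ξ).2 hξ), h4,
      swapPt_swapPt]
  · rw [Set.indicator_of_notMem hξ, Set.indicator_of_notMem (mt (swapPt_mem_coneH ξ).1 hξ)]

theorem det_shearV_mul_dilV_ne_zero (s : ℝ) {a : ℝ} (ha : a ≠ 0) :
    (shearV s * dilV a).det ≠ 0 := by
  rw [Matrix.det_mul]
  simp [shearV, dilV, ha]

/-- The vertical matrices are the horizontal ones conjugated by the coordinate exchange. This is
checked on the matrices themselves, which avoids computing inverses. -/
theorem swapPt_act_vertical (s : ℝ) {a : ℝ} (ha : a ≠ 0) (x : Plane) :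
    swapPt (act (dilV a)⁻¹ (act (shearV s)⁻¹ x)) =
      act (dil a)⁻¹ (act (shear s)⁻¹ (swapPt x)) := by
  have h1 := act_inv_cancel (det_shearV_mul_dilV_ne_zero s ha) x
  rw [Matrix.mul_inv_rev, act_mul, act_mul] at h1
  set z := act (dilV a)⁻¹ (act (shearV s)⁻¹ x)
  have h2 : swapPt x = act (shear s) (act (dil a) (swapPt z)) := by
    rw [← h1, act_apply, act_apply, act_apply, act_apply]
    ext i; fin_cases i <;> simp [swapPt, shear, shearV, dil, dilV]
    ring
  rw [h2, ← act_mul (shear s), ← act_mul (dil a)⁻¹, ← Matrix.mul_inv_rev, ← act_mul,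
    Matrix.nonsing_inv_mul _ (Ne.isUnit (det_shear_mul_dil_ne_zero s ha)), act_apply]
  simpa using (plane_eta (swapPt z)).symm

theorem shearletTransformV_eq {ψ f : Plane → ℂ} (hψ : MemLp ψ 2 volume) (hf : MemLp f 2 volume)
    (b : Plane) (s : ℝ) {a : ℝ} (ha : a ≠ 0) :
    shearletTransformV (swapped ψ) (freqProj coneV f) b s a =
      shearletTransform ψ (freqProj coneH fun x => f (swapPt x)) (swapPt b) s a := by
  have h1 : shearletRepV b s a (swapped ψ) =ᵐ[volume]
      fun x => shearletRep (swapPt b) s a ψ (swapPt x) := by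
    have h0 := (quasiMeasurePreserving_act (det_inv_ne_zero
      (det_shearV_mul_dilV_ne_zero s ha))).ae (swapped_ae_eq hψ)
    have h2 := (measurePreserving_sub_right volume b).quasiMeasurePreserving.ae h0
    filter_upwards [h2] with x hx
    rw [Matrix.mul_inv_rev, act_mul] at hx
    rw [shearletRepV, shearletRep, hx, swapPt_act_vertical s ha, swapPt_sub]
  rw [shearletTransformV, ip_congr (freqProj_coneV_ae_eq hf) h1]
  exact measurePreserving_swapPt.integral_comp measurableEmbedding_swapPt
    (fun x => freqProj coneH (fun x => f (swapPt x)) x * star (shearletRep (swapPt b) s a ψ x))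

end Swap

/-! ### The reconstruction formula -/

section Reconstruction

theorem enorm_star_complex (z : ℂ) : ‖star z‖ₑ = ‖z‖ₑ := by
  rw [← ofReal_norm, ← ofReal_norm, norm_star]

/-- Plancherel's identity for integrable functions, with values in `[0, ∞]`. -/
theorem lintegral_fourier_sq {E : Type*} [NormedAddCommGroup E] [InnerProductSpace ℝ E]
    [FiniteDimensional ℝ E] [MeasurableSpace E] [BorelSpace E] {F : E → ℂ} (hF : Integrable F) :
    ∫⁻ b, ‖𝓕 F b‖ₑ ^ 2 = ∫⁻ ξ, ‖F ξ‖ₑ ^ 2 := by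
  by_cases h : MemLp F 2 volume
  · rw [← eLpNorm_two_sq, ← eLpNorm_two_sq, ← eLpNorm_fourierL2 h,
      eLpNorm_congr_ae (fourierL2_ae_eq_fourier hF h)]
  -- Outside `L²` both sides are infinite: a square-integrable transform would force `F` into `L²`.
  · have h1 : ∫⁻ ξ, ‖F ξ‖ₑ ^ 2 = ⊤ := by
      by_contra hne
      exact h (memLp_two_iff.2 ⟨hF.1, lt_top_iff_ne_top.2 hne⟩)
    have h2 : ∫⁻ b, ‖𝓕 F b‖ₑ ^ 2 = ⊤ := by
      by_contra hne
      exact h (memLp_two_of_fourier hF (memLp_two_iff.2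
        ⟨(continuous_fourier hF).aestronglyMeasurable, lt_top_iff_ne_top.2 hne⟩))
    rw [h1, h2]

/-- The integral is `𝓕 F (-b)`, and reflection preserves the measure. No square-integrability of `F`
is needed, so it applies to a product of two `L²` functions. -/
theorem lintegral_expI_sq {E : Type*} [NormedAddCommGroup E] [InnerProductSpace ℝ E]
    [FiniteDimensional ℝ E] [MeasurableSpace E] [BorelSpace E] {F : E → ℂ} (hF : Integrable F) :
    ∫⁻ b, ‖∫ ξ, expI (inner ℝ b ξ) * F ξ‖ₑ ^ 2 = ∫⁻ ξ, ‖F ξ‖ₑ ^ 2 := by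
  rw [← lintegral_fourier_sq hF, ← lintegral_neg_eq_self (fun b => ‖𝓕 F b‖ₑ ^ 2)]
  refine lintegral_congr fun b => ?_
  rw [fourier_eq_expI]
  simp only [inner_neg_right, neg_neg, real_inner_comm]

/-- The contribution of the shearlets to the window condition. -/
noncomputable def shearletWeight (ψ : Plane → ℂ) (ξ : Plane) : ℝ≥0∞ :=
  ∫⁻ a in Set.Icc (-1 : ℝ) 1, ∫⁻ s in Set.Icc (-2 : ℝ) 2,
    ‖fourierL2 ψ (act (dil a) (act (shear s).transpose ξ))‖ₑ ^ 2
      * ENNReal.ofReal (|a| ^ (-(3 / 2 : ℝ)))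

theorem measurable_dil_shear : Measurable fun p : (ℝ × ℝ) × Plane =>
    act (dil p.1.1) (act (shear p.1.2).transpose p.2) := by
  simp only [act_dil_shear]
  fun_prop

theorem measurable_weight_integrand (ψ : Plane → ℂ) : Measurable fun p : (ℝ × ℝ) × Plane =>
    ‖fourierL2 ψ (act (dil p.1.1) (act (shear p.1.2).transpose p.2))‖ₑ ^ 2
      * ENNReal.ofReal (|p.1.1| ^ (-(3 / 2 : ℝ))) :=
  (((measurable_enorm_fourierL2 ψ).comp measurable_dil_shear).pow_const 2).mul (by fun_prop)

theorem measurable_shearletWeight (ψ : Plane → ℂ) : Measurable (shearletWeight ψ) := by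
  have h1 : Measurable fun q : Plane × ℝ => ∫⁻ s in Set.Icc (-2 : ℝ) 2,
      ‖fourierL2 ψ (act (dil q.2) (act (shear s).transpose q.1))‖ₑ ^ 2
      * ENNReal.ofReal (|q.2| ^ (-(3 / 2 : ℝ))) :=
    Measurable.lintegral_prod_right' (f := fun r : (Plane × ℝ) × ℝ =>
      ‖fourierL2 ψ (act (dil r.1.2) (act (shear r.2).transpose r.1.1))‖ₑ ^ 2
      * ENNReal.ofReal (|r.1.2| ^ (-(3 / 2 : ℝ))))
      ((measurable_weight_integrand ψ).comp
        (f := fun r : (Plane × ℝ) × ℝ => ((r.1.2, r.2), r.1.1)) (by fun_prop))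
  exact Measurable.lintegral_prod_right' h1

/-- Reconciles the measure `da/|a|³` of the norm formula with `da/|a|^{3/2}` in the window
condition: the squared spectrum carries `|a|^{3/2}`. -/
theorem rpow_weight {a : ℝ} (ha : a ≠ 0) :
    ‖|a| ^ (3 / 4 : ℝ)‖ₑ ^ 2 * ENNReal.ofReal (|a| ^ (-(3 : ℝ))) =
      ENNReal.ofReal (|a| ^ (-(3 / 2 : ℝ))) := by
  have ha' : 0 < |a| := abs_pos.2 ha
  have hp := Real.rpow_pos_of_pos ha' (3 / 4)
  rw [Real.enorm_eq_ofReal hp.le, ← ENNReal.ofReal_pow hp.le,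
    ← ENNReal.ofReal_mul (by positivity), ← Real.rpow_natCast, ← Real.rpow_mul ha'.le,
    ← Real.rpow_add ha']
  norm_num

theorem lintegral_lintegral_lintegral_swap {c : Plane → ℝ≥0∞} {K : ℝ → ℝ → Plane → ℝ≥0∞}
    (hc : Measurable c) (hK : Measurable fun p : (ℝ × ℝ) × Plane => K p.1.1 p.1.2 p.2)
    (A B : Set ℝ) :
    ∫⁻ a in A, ∫⁻ s in B, ∫⁻ ξ, c ξ * K a s ξ = ∫⁻ ξ, c ξ * ∫⁻ a in A, ∫⁻ s in B, K a s ξ := by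
  have h3 : ∀ a, ∫⁻ s in B, ∫⁻ ξ, c ξ * K a s ξ = ∫⁻ ξ, c ξ * ∫⁻ s in B, K a s ξ := by
    intro a
    have hm : Measurable fun p : ℝ × Plane => K a p.1 p.2 :=
      hK.comp (f := fun p : ℝ × Plane => ((a, p.1), p.2)) (by fun_prop)
    rw [lintegral_lintegral_swap (by exact ((hc.comp measurable_snd).mul hm).aemeasurable)]
    refine lintegral_congr fun ξ => ?_
    have hm' : Measurable fun s => K a s ξ := hm.comp (f := fun s => (s, ξ)) (by fun_prop)
    rw [lintegral_const_mul _ hm']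
  have hm2 : Measurable fun q : ℝ × Plane => ∫⁻ s in B, K q.1 s q.2 :=
    Measurable.lintegral_prod_right' (f := fun r : (ℝ × Plane) × ℝ => K r.1.1 r.2 r.1.2)
      (hK.comp (f := fun r : (ℝ × Plane) × ℝ => ((r.1.1, r.2), r.1.2)) (by fun_prop))
  simp only [h3]
  rw [lintegral_lintegral_swap (by exact ((hc.comp measurable_snd).mul hm2).aemeasurable)]
  refine lintegral_congr fun ξ => ?_
  have hm' : Measurable fun a => ∫⁻ s in B, K a s ξ := hm2.comp (f := fun a => (a, ξ)) (by fun_prop)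
  rw [lintegral_const_mul _ hm']

/-- Plancherel in `b` for each `(s, a)`, then Tonelli; the value `a = 0` is negligible. -/
theorem lintegral_shearletTransform_sq {ψ : Plane → ℂ} (hψ : MemLp ψ 2 volume) (f : Plane → ℂ) :
    (∫⁻ a in Set.Icc (-1 : ℝ) 1, ∫⁻ s in Set.Icc (-2 : ℝ) 2, ∫⁻ b : Plane,
      ‖shearletTransform ψ (freqProj coneH f) b s a‖ₑ ^ 2
        * ENNReal.ofReal (|a| ^ (-(3 : ℝ)))) =
    ∫⁻ ξ, ‖fourierL2 f ξ‖ₑ ^ 2 * coneH.indicator (shearletWeight ψ) ξ := by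
  set c : Plane → ℝ≥0∞ := fun ξ => ‖coneH.indicator (fourierL2 f) ξ‖ₑ ^ 2 with hc
  have hcm : Measurable c := by
    have := ((stronglyMeasurable_fourierL2 f).indicator measurableSet_coneH).measurable
    fun_prop
  set K : ℝ → ℝ → Plane → ℝ≥0∞ := fun a s ξ =>
    ‖fourierL2 ψ (act (dil a) (act (shear s).transpose ξ))‖ₑ ^ 2
      * ENNReal.ofReal (|a| ^ (-(3 / 2 : ℝ))) with hK
  have hKm : Measurable fun p : (ℝ × ℝ) × Plane => K p.1.1 p.1.2 p.2 :=
    measurable_weight_integrand ψ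
  have h1 : ∀ᵐ a : ℝ, ∀ s : ℝ, ∫⁻ b : Plane, ‖shearletTransform ψ (freqProj coneH f) b s a‖ₑ ^ 2
        * ENNReal.ofReal (|a| ^ (-(3 : ℝ))) = ∫⁻ ξ, c ξ * K a s ξ := by
    filter_upwards [ae_ne_zero] with a ha s
    rw [lintegral_mul_const' _ _ ENNReal.ofReal_ne_top]
    simp only [shearletTransform_eq hψ f _ s ha]
    rw [lintegral_expI_sq (integrable_shearletSpectrum ψ f s ha),
      ← lintegral_mul_const' _ _ ENNReal.ofReal_ne_top]
    refine lintegral_congr fun ξ => ?_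
    simp only [hK, hc]
    rw [shearletSpectrum, enorm_mul, enorm_mul, enorm_star_complex, enorm_ofReal, ← rpow_weight ha]
    ring
  have h2 : (∫⁻ a in Set.Icc (-1 : ℝ) 1, ∫⁻ s in Set.Icc (-2 : ℝ) 2, ∫⁻ b : Plane,
      ‖shearletTransform ψ (freqProj coneH f) b s a‖ₑ ^ 2
        * ENNReal.ofReal (|a| ^ (-(3 : ℝ)))) =
      ∫⁻ a in Set.Icc (-1 : ℝ) 1, ∫⁻ s in Set.Icc (-2 : ℝ) 2, ∫⁻ ξ, c ξ * K a s ξ := by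
    refine lintegral_congr_ae (ae_restrict_of_ae ?_)
    filter_upwards [h1] with a ha
    exact lintegral_congr fun s => ha s
  rw [h2, lintegral_lintegral_lintegral_swap hcm hKm]
  refine lintegral_congr fun ξ => ?_
  simp only [hc]
  by_cases hξ : ξ ∈ coneH
  · rw [Set.indicator_of_mem hξ, Set.indicator_of_mem hξ]; rfl
  · rw [Set.indicator_of_notMem hξ, Set.indicator_of_notMem hξ]; simp

theorem lintegral_shearletTransformV_sq {ψ f : Plane → ℂ} (hψ : MemLp ψ 2 volume)
    (hf : MemLp f 2 volume) :
    (∫⁻ a in Set.Icc (-1 : ℝ) 1, ∫⁻ s in Set.Icc (-2 : ℝ) 2, ∫⁻ b : Plane,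
      ‖shearletTransformV (swapped ψ) (freqProj coneV f) b s a‖ₑ ^ 2
        * ENNReal.ofReal (|a| ^ (-(3 : ℝ)))) =
    ∫⁻ ξ, ‖fourierL2 f ξ‖ₑ ^ 2 * coneV.indicator (fun ξ => shearletWeight ψ (swapPt ξ)) ξ := by
  have h1 := lintegral_shearletTransform_sq hψ fun x => f (swapPt x)
  have h2 : (∫⁻ a in Set.Icc (-1 : ℝ) 1, ∫⁻ s in Set.Icc (-2 : ℝ) 2, ∫⁻ b : Plane,
      ‖shearletTransformV (swapped ψ) (freqProj coneV f) b s a‖ₑ ^ 2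
        * ENNReal.ofReal (|a| ^ (-(3 : ℝ)))) =
      ∫⁻ a in Set.Icc (-1 : ℝ) 1, ∫⁻ s in Set.Icc (-2 : ℝ) 2, ∫⁻ b : Plane,
      ‖shearletTransform ψ (freqProj coneH fun x => f (swapPt x)) b s a‖ₑ ^ 2
        * ENNReal.ofReal (|a| ^ (-(3 : ℝ))) := by
    refine lintegral_congr_ae (ae_restrict_of_ae ?_)
    filter_upwards [ae_ne_zero] with a ha
    refine lintegral_congr fun s => ?_
    simp only [shearletTransformV_eq hψ hf _ s ha]
    exact measurePreserving_swapPt.lintegral_comp_emb measurableEmbedding_swapPt (fun b =>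
      ‖shearletTransform ψ (freqProj coneH fun x => f (swapPt x)) b s a‖ₑ ^ 2
        * ENNReal.ofReal (|a| ^ (-(3 : ℝ))))
  rw [h2, h1, ← measurePreserving_swapPt.lintegral_comp_emb measurableEmbedding_swapPt]
  refine lintegral_congr_ae ?_
  filter_upwards [ae_swapPt (fourierL2_comp_swapPt hf)] with ξ hξ
  rw [hξ, swapPt_swapPt]
  rfl

/-! ### The window condition in terms of `ψ` alone -/

theorem swapPt_dilV_shear (a s : ℝ) (ξ : Plane) :
    swapPt (act (dilV a) (act (shear s) ξ)) =
      act (dil a) (act (shear s).transpose (swapPt ξ)) := by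
  rw [act_dil_shear, act_apply, act_apply]
  ext i; fin_cases i <;> simp [swapPt, dilV, shear]
  ring_nf; simp

theorem det_dilV_mul_shear_ne_zero (s : ℝ) {a : ℝ} (ha : a ≠ 0) : (dilV a * shear s).det ≠ 0 := by
  rw [Matrix.det_mul]
  simp [shear, dilV, ha]

theorem measurable_dilV_shear : Measurable fun p : (ℝ × ℝ) × Plane =>
    act (dilV p.1.1) (act (shear p.1.2) p.2) := by
  have : ∀ p : (ℝ × ℝ) × Plane, act (dilV p.1.1) (act (shear p.1.2) p.2) =
      swapPt (act (dil p.1.1) (act (shear p.1.2).transpose (swapPt p.2))) := fun p => by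
    rw [← swapPt_dilV_shear, swapPt_swapPt]
  simp only [this]
  exact measurable_swapPt.comp (measurable_dil_shear.comp
    (f := fun p : (ℝ × ℝ) × Plane => (p.1, swapPt p.2)) (by fun_prop))

/-- A measurable property holding for almost every frequency, for all nonzero dilations,
holds for almost every dilation and shear, for almost every frequency. -/
theorem ae_ae_dil_shear {p : ℝ → ℝ → Plane → Prop}
    (hm : MeasurableSet {q : (ℝ × ℝ) × Plane | p q.1.1 q.1.2 q.2})
    (h : ∀ a s, a ≠ 0 → ∀ᵐ ξ, p a s ξ) : ∀ᵐ ξ, ∀ᵐ a, ∀ᵐ s, p a s ξ := by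
  have h1 : ∀ᵐ z : ℝ × ℝ, ∀ᵐ ξ, p z.1 z.2 ξ := by
    have : ∀ᵐ z : ℝ × ℝ, z.1 ≠ 0 := Measure.quasiMeasurePreserving_fst.ae ae_ne_zero
    filter_upwards [this] with z hz
    exact h _ _ hz
  filter_upwards [(Measure.ae_ae_comm hm).1 h1] with ξ hξ
  exact Measure.ae_ae_of_ae_prod hξ

theorem windowCondition_swap {ψ g : Plane → ℂ} (hW : WindowCondition ψ g) :
    ∀ᵐ ξ : Plane, ‖fourierL2 g ξ‖ₑ ^ 2 + coneH.indicator (shearletWeight ψ) ξ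
      + coneV.indicator (fun ξ => shearletWeight ψ (swapPt ξ)) ξ = 1 := by
  -- `ℱψᵛ` is known only almost everywhere. Invertible matrices pull null sets back to null sets for
  -- each `(a, s)`, and Fubini exchanges the quantifiers.
  have h1 : ∀ᵐ ξ : Plane, ∀ᵐ a : ℝ, ∀ᵐ s : ℝ,
      fourierL2 (swapped ψ) (act (dilV a) (act (shear s) ξ)) =
        fourierL2 ψ (swapPt (act (dilV a) (act (shear s) ξ))) := by
    refine ae_ae_dil_shear (p := fun a s ξ => fourierL2 (swapped ψ) (act (dilV a) (act (shear s) ξ))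
      = fourierL2 ψ (swapPt (act (dilV a) (act (shear s) ξ)))) ?_ fun a s ha => ?_
    · exact measurableSet_eq_fun
        ((stronglyMeasurable_fourierL2 _).measurable.comp measurable_dilV_shear)
        ((stronglyMeasurable_fourierL2 _).measurable.comp
          (measurable_swapPt.comp measurable_dilV_shear))
    · have := (quasiMeasurePreserving_act (det_dilV_mul_shear_ne_zero s ha)).ae
        (fourierL2_swapped ψ)
      simpa only [act_mul] using this
  filter_upwards [hW, h1] with ξ hξ h2
  rw [← hξ]
  congr 1
  by_cases hv : ξ ∈ coneV
  · rw [Set.indicator_of_mem hv, Set.indicator_of_mem hv, shearletWeight]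
    refine lintegral_congr_ae (ae_restrict_of_ae ?_)
    filter_upwards [h2] with a ha
    refine lintegral_congr_ae (ae_restrict_of_ae ?_)
    filter_upwards [ha] with s hs
    rw [hs, swapPt_dilV_shear]
  · rw [Set.indicator_of_notMem hv, Set.indicator_of_notMem hv]

theorem reconstruction {ψ g f : Plane → ℂ} (hψ : MemLp ψ 2 volume) (hg₂ : MemLp g 2 volume)
    (hW : WindowCondition ψ g) (hf₂ : MemLp f 2 volume) :
    eLpNorm f 2 volume ^ 2 =
        (∫⁻ b : Plane, ‖ip f (translateBy b g)‖ₑ ^ 2)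
        + (∫⁻ a in Set.Icc (-1 : ℝ) 1, ∫⁻ s in Set.Icc (-2 : ℝ) 2, ∫⁻ b : Plane,
            ‖shearletTransform ψ (freqProj coneH f) b s a‖ₑ ^ 2
              * ENNReal.ofReal (|a| ^ (-(3 : ℝ))))
        + (∫⁻ a in Set.Icc (-1 : ℝ) 1, ∫⁻ s in Set.Icc (-2 : ℝ) 2, ∫⁻ b : Plane,
            ‖shearletTransformV (swapped ψ) (freqProj coneV f) b s a‖ₑ ^ 2
              * ENNReal.ofReal (|a| ^ (-(3 : ℝ)))) := by
  have hfm := measurable_enorm_fourierL2 f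
  have hgm := measurable_enorm_fourierL2 g
  have hwm := measurable_shearletWeight ψ
  have hg : ∫⁻ b : Plane, ‖ip f (translateBy b g)‖ₑ ^ 2 =
      ∫⁻ ξ, ‖fourierL2 f ξ‖ₑ ^ 2 * ‖fourierL2 g ξ‖ₑ ^ 2 := by
    simp only [ip_translateBy hf₂ hg₂]
    rw [lintegral_expI_sq (integrable_mul_star_fourierL2 f g)]
    refine lintegral_congr fun ξ => ?_
    rw [enorm_mul, enorm_star_complex, mul_pow]
  have hm : Measurable fun ξ => ‖fourierL2 f ξ‖ₑ ^ 2 * ‖fourierL2 g ξ‖ₑ ^ 2 +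
      ‖fourierL2 f ξ‖ₑ ^ 2 * coneH.indicator (shearletWeight ψ) ξ :=
    ((hfm.pow_const 2).mul (hgm.pow_const 2)).add
      ((hfm.pow_const 2).mul (hwm.indicator measurableSet_coneH))
  rw [hg, lintegral_shearletTransform_sq hψ, lintegral_shearletTransformV_sq hψ hf₂,
    ← lintegral_add_left (by fun_prop), ← lintegral_add_left hm,
    ← eLpNorm_fourierL2 hf₂, eLpNorm_two_sq]
  refine lintegral_congr_ae ?_
  filter_upwards [windowCondition_swap hW] with ξ hξ
  rw [← mul_add, ← mul_add, hξ, mul_one]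

end Reconstruction

/-! ### Square-integrability of `|τ| ℱ(ℛg(v, ·))` -/

section Domain

/-! ### Fourier transforms of iterated derivatives -/

theorem fourierL2_iteratedFDeriv {E : Type*} [NormedAddCommGroup E] [InnerProductSpace ℝ E]
    [FiniteDimensional ℝ E] [MeasurableSpace E] [BorelSpace E] {h : E → ℂ}
    (hs : ContDiff ℝ ∞ h) (hd : ∀ n : ℕ, MemLp (iteratedFDeriv ℝ n h) 2 volume) (m : E) (n : ℕ) :
    MemLp (fun x => iteratedFDeriv ℝ n h x fun _ => m) 2 volume ∧
    fourierL2 (fun x => iteratedFDeriv ℝ n h x fun _ => m) =ᵐ[volume]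
      fun ξ => ((2 * Real.pi * Complex.I) * (inner ℝ ξ m : ℝ)) ^ n * fourierL2 h ξ := by
  have hcd : ∀ n : ℕ, ContDiff ℝ ∞ fun x => iteratedFDeriv ℝ n h x fun _ => m := fun n =>
    (ContinuousMultilinearMap.apply ℝ (fun _ : Fin n => E) ℂ fun _ => m).contDiff.comp
      (hs.iteratedFDeriv_right (m := ∞) (by norm_cast))
  have hmem : ∀ n : ℕ, MemLp (fun x => iteratedFDeriv ℝ n h x fun _ => m) 2 volume := by
    intro n
    refine (hd n).of_le_mul (c := ‖m‖ ^ n) (hcd n).continuous.aestronglyMeasurable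
      (Filter.Eventually.of_forall fun x => ?_)
    have := (iteratedFDeriv ℝ n h x).le_opNorm fun _ => m
    rw [Finset.prod_const, Finset.card_univ, Fintype.card_fin] at this
    rwa [mul_comm]
  refine ⟨hmem n, ?_⟩
  induction n with
  | zero => simp
  | succ n ih =>
    have hdiff : Differentiable ℝ fun x => iteratedFDeriv ℝ n h x fun _ => m :=
      (hcd n).differentiable (by norm_num)
    have hder : ∀ x, fderiv ℝ (fun x => iteratedFDeriv ℝ n h x fun _ => m) x m =
        iteratedFDeriv ℝ (n + 1) h x fun _ => m := by
      intro x
      have h1 : DifferentiableAt ℝ (iteratedFDeriv ℝ n h) x :=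
        (hs.differentiable_iteratedFDeriv (by exact_mod_cast ENat.natCast_lt_top n)) x
      have h2 := ((ContinuousMultilinearMap.apply ℝ (fun _ : Fin n => E) ℂ
        fun _ => m).hasFDerivAt.comp x h1.hasFDerivAt).fderiv
      have h3 : fderiv ℝ (fun x => iteratedFDeriv ℝ n h x fun _ => m) x =
        (ContinuousMultilinearMap.apply ℝ (fun _ : Fin n => E) ℂ fun _ => m).comp
          (fderiv ℝ (iteratedFDeriv ℝ n h) x) := h2
      rw [h3, iteratedFDeriv_succ_apply_left]
      rfl
    have hf := fourierL2_fderiv (hmem n) hdiff m (by simpa only [hder] using hmem (n + 1))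
    simp only [hder] at hf
    filter_upwards [hf, ih] with ξ h1 h2
    rw [h1, h2, pow_succ']
    ring

theorem lintegral_inner_pow_fourierL2 {E : Type*} [NormedAddCommGroup E] [InnerProductSpace ℝ E]
    [FiniteDimensional ℝ E] [MeasurableSpace E] [BorelSpace E] {h : E → ℂ}
    (hs : ContDiff ℝ ∞ h) (hd : ∀ n : ℕ, MemLp (iteratedFDeriv ℝ n h) 2 volume) (m : E) (n : ℕ) :
    ∫⁻ ξ, (‖(inner ℝ ξ m : ℝ)‖ₑ ^ n * ‖fourierL2 h ξ‖ₑ) ^ 2 < ⊤ := by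
  obtain ⟨h1, h2⟩ := fourierL2_iteratedFDeriv hs hd m n
  refine lt_of_le_of_lt ?_ (memLp_two_iff.1 (memLp_fourierL2
    fun x => iteratedFDeriv ℝ n h x fun _ => m)).2
  refine lintegral_mono_ae ?_
  filter_upwards [h2] with ξ hξ
  rw [hξ, enorm_mul, enorm_pow, enorm_mul, enorm_ofReal]
  gcongr
  -- The constant `|2πi|` is at least 1 and can be dropped.
  refine le_mul_of_one_le_left' ?_
  rw [← ofReal_norm, ENNReal.one_le_ofReal]
  have : (1 : ℝ) ≤ 2 * Real.pi := by linarith [Real.pi_gt_three]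
  simpa [abs_of_pos Real.pi_pos] using this

/-- The bound for `|ℱg(ξ)|²` on the cones: the part of the admissibility integral outside of the
region of integration of the window condition. -/
noncomputable def tailBound (u : ℝ → ℝ≥0∞) (W W8 : ℝ≥0∞) (τ : ℝ) : ℝ≥0∞ :=
  ∫⁻ a, u (a * τ) * ((Set.Icc (-1 : ℝ) 1).indicator (fun a => ‖a‖ₑ ^ 3 * W8) a +
    (Set.Icc (-1 : ℝ) 1)ᶜ.indicator (fun a => ‖a‖ₑ⁻¹ * W) a)

/-! ### Integrability of the tail bound -/

theorem measurable_tailBound_integrand {u : ℝ → ℝ≥0∞} (hu : Measurable u) (W W8 : ℝ≥0∞) :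
    Measurable fun p : ℝ × ℝ => u (p.2 * p.1) *
      ((Set.Icc (-1 : ℝ) 1).indicator (fun a => ‖a‖ₑ ^ 3 * W8) p.2 +
        (Set.Icc (-1 : ℝ) 1)ᶜ.indicator (fun a => ‖a‖ₑ⁻¹ * W) p.2) := by
  have h1 : Measurable ((Set.Icc (-1 : ℝ) 1).indicator fun a => ‖a‖ₑ ^ 3 * W8) :=
    Measurable.indicator (by fun_prop) measurableSet_Icc
  have h2 : Measurable ((Set.Icc (-1 : ℝ) 1)ᶜ.indicator fun a => ‖a‖ₑ⁻¹ * W) :=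
    Measurable.indicator (by fun_prop) measurableSet_Icc.compl
  fun_prop

theorem measurable_tailBound {u : ℝ → ℝ≥0∞} (hu : Measurable u) (W W8 : ℝ≥0∞) :
    Measurable (tailBound u W W8) :=
  Measurable.lintegral_prod_right' (measurable_tailBound_integrand hu W W8)

theorem lintegral_inv_pow_four : ∫⁻ a in (Set.Icc (-1 : ℝ) 1)ᶜ, ‖a‖ₑ⁻¹ ^ 4 < ⊤ := by
  -- For `|a| > 1`, `|a|^{-4}` is at most `2 / (1 + a²)`.
  have h1 : ∫⁻ a : ℝ, ENNReal.ofReal (2 * (1 + a ^ 2)⁻¹) < ⊤ :=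
    (integrable_inv_one_add_sq.const_mul 2).lintegral_lt_top
  refine lt_of_le_of_lt ?_ h1
  refine le_trans (setLIntegral_mono' measurableSet_Icc.compl fun a ha => ?_)
    (setLIntegral_le_lintegral _ _)
  have h2 : 1 < |a| := by
    by_contra hlt
    exact ha (abs_le.1 (not_lt.1 hlt))
  have h3 : 1 < a ^ 2 := by rw [← sq_abs]; nlinarith
  rw [Real.enorm_eq_ofReal_abs, ← ENNReal.ofReal_inv_of_pos (by linarith),
    ← ENNReal.ofReal_pow (by positivity)]
  refine ENNReal.ofReal_le_ofReal ?_
  rw [inv_pow, show |a| ^ 4 = a ^ 2 * a ^ 2 by rw [← sq_abs]; ring, ← div_eq_mul_inv,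
    inv_eq_one_div, div_le_div_iff₀ (by positivity) (by positivity)]
  nlinarith

theorem enorm_ne_zero_top {a : ℝ} (ha : a ≠ 0) : ‖a‖ₑ ≠ 0 ∧ ‖a‖ₑ ≠ ⊤ :=
  ⟨enorm_ne_zero.2 ha, enorm_ne_top⟩

/-- Two powers of `|a|⁻¹` come from the weight and one from the Jacobian. -/
theorem lintegral_sq_mul_comp {G : ℝ → ℝ≥0∞} (hG : Measurable G) {a : ℝ} (ha : a ≠ 0) :
    ∫⁻ τ, ‖τ‖ₑ ^ 2 * G (a * τ) = ‖a‖ₑ⁻¹ ^ 3 * ∫⁻ τ, ‖τ‖ₑ ^ 2 * G τ := by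
  obtain ⟨h0, ht⟩ := enorm_ne_zero_top ha
  have hm : Measurable fun v => ‖v‖ₑ ^ 2 * G (a * v) := by fun_prop
  rw [lintegral_comp_mul_const (G := fun τ => ‖τ‖ₑ ^ 2 * G τ) (by fun_prop) ha]
  have : ∀ v : ℝ, ‖v * a‖ₑ ^ 2 * G (v * a) = ‖a‖ₑ ^ 2 * (‖v‖ₑ ^ 2 * G (a * v)) := fun v => by
    rw [enorm_mul, mul_comm v a]; ring
  simp only [this]
  rw [lintegral_const_mul _ hm, ← mul_assoc, ← mul_assoc, ← ENNReal.inv_pow, mul_assoc (_)⁻¹,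
    ← pow_succ', ENNReal.inv_mul_cancel (pow_ne_zero _ h0) (ENNReal.pow_ne_top ht), one_mul]

theorem lintegral_sq_mul_tailBound {u : ℝ → ℝ≥0∞} (hu : Measurable u) {W W8 : ℝ≥0∞} (hW : W < ⊤)
    (hW8 : W8 < ⊤) (hu2 : ∫⁻ τ, ‖τ‖ₑ ^ 2 * u τ < ⊤) :
    ∫⁻ τ, ‖τ‖ₑ ^ 2 * tailBound u W W8 τ < ⊤ := by
  set U := ∫⁻ τ, ‖τ‖ₑ ^ 2 * u τ with hU
  set k : ℝ → ℝ≥0∞ := fun a => (Set.Icc (-1 : ℝ) 1).indicator (fun a => ‖a‖ₑ ^ 3 * W8) a +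
    (Set.Icc (-1 : ℝ) 1)ᶜ.indicator (fun a => ‖a‖ₑ⁻¹ * W) a with hk
  have hkm : Measurable k :=
    (Measurable.indicator (by fun_prop) measurableSet_Icc).add
      (Measurable.indicator (by fun_prop) measurableSet_Icc.compl)
  have h1 : ∀ τ : ℝ, ‖τ‖ₑ ^ 2 * tailBound u W W8 τ = ∫⁻ a, ‖τ‖ₑ ^ 2 * (u (a * τ) * k a) :=
    fun τ => by rw [lintegral_const_mul _ (by fun_prop)]; rfl
  simp only [h1]
  rw [lintegral_lintegral_swap (by fun_prop)]
  -- The factor `|a|^{-3}` of the `τ`-integral cancels `|a|³` on `[-1, 1]`, which is why `tailBound`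
  -- uses an eighth moment, and outside it combines with `|a|⁻¹` into the integrable `|a|^{-4}`.
  have h2 : ∫⁻ a, ∫⁻ τ, ‖τ‖ₑ ^ 2 * (u (a * τ) * k a) =
      ∫⁻ a, ((Set.Icc (-1 : ℝ) 1).indicator (fun _ => U * W8) a +
        (Set.Icc (-1 : ℝ) 1)ᶜ.indicator (fun a => U * W * ‖a‖ₑ⁻¹ ^ 4) a) := by
    refine lintegral_congr_ae ?_
    filter_upwards [ae_ne_zero] with a ha
    obtain ⟨h0, ht⟩ := enorm_ne_zero_top ha
    simp only [← mul_assoc]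
    rw [lintegral_mul_const _ (by fun_prop), lintegral_sq_mul_comp hu ha, ← hU, hk]
    simp only
    by_cases hm : a ∈ Set.Icc (-1 : ℝ) 1
    · have hm' : a ∉ (Set.Icc (-1 : ℝ) 1)ᶜ := fun h => h hm
      rw [Set.indicator_of_mem hm, Set.indicator_of_mem hm, Set.indicator_of_notMem hm',
        Set.indicator_of_notMem hm', add_zero, add_zero, ← ENNReal.inv_pow]
      calc (‖a‖ₑ ^ 3)⁻¹ * U * (‖a‖ₑ ^ 3 * W8) = ((‖a‖ₑ ^ 3)⁻¹ * ‖a‖ₑ ^ 3) * (U * W8) := by ring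
        _ = _ := by
          rw [ENNReal.inv_mul_cancel (pow_ne_zero _ h0) (ENNReal.pow_ne_top ht), one_mul]
    · rw [Set.indicator_of_notMem hm, Set.indicator_of_notMem hm, Set.indicator_of_mem hm,
        Set.indicator_of_mem hm, zero_add, zero_add]
      ring
  rw [h2, lintegral_add_left (measurable_const.indicator measurableSet_Icc),
    lintegral_indicator measurableSet_Icc, lintegral_indicator measurableSet_Icc.compl,
    setLIntegral_const, lintegral_const_mul _ (by fun_prop)]
  refine ENNReal.add_lt_top.2 ⟨?_, ?_⟩
  · exact ENNReal.mul_lt_top (ENNReal.mul_lt_top hu2 hW8) (by simp)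
  · exact ENNReal.mul_lt_top (ENNReal.mul_lt_top hu2 hW) lintegral_inv_pow_four

theorem lintegral_comp_sub_div {w : ℝ → ℝ≥0∞} (hw : Measurable w) (v : ℝ) {c : ℝ} (hc : 0 < c) :
    ∫⁻ s, w ((v - s) / c) = ENNReal.ofReal c * ∫⁻ r, w r := by
  rw [lintegral_sub_left_eq_self (fun t => w (t / c)) v,
    lintegral_comp_mul_const (G := fun t => w (t / c)) (by fun_prop) hc.ne', Real.enorm_eq_ofReal hc.le]
  simp only [mul_div_cancel_right₀ _ hc.ne']

theorem rpow_dilation {a : ℝ} (ha : a ≠ 0) :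
    ENNReal.ofReal (|a| ^ (-(3 / 2 : ℝ))) * ENNReal.ofReal (|a| ^ (1 / 2 : ℝ)) = ‖a‖ₑ⁻¹ := by
  have ha' : 0 < |a| := abs_pos.2 ha
  rw [← ENNReal.ofReal_mul (by positivity), ← Real.rpow_add ha', Real.enorm_eq_ofReal_abs,
    ← ENNReal.ofReal_inv_of_pos ha', ← Real.rpow_neg_one]
  norm_num

theorem lintegral_comp_mul_mul_inv {u : ℝ → ℝ≥0∞} (hu : Measurable u) {τ : ℝ} (hτ : τ ≠ 0) :
    ∫⁻ a, u (a * τ) * ‖a‖ₑ⁻¹ = ∫⁻ t, u t / ‖t‖ₑ := by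
  obtain ⟨h0, ht⟩ := enorm_ne_zero_top hτ
  rw [lintegral_comp_mul_const (G := fun t => u t / ‖t‖ₑ) (by fun_prop) hτ,
    ← lintegral_const_mul _ (by fun_prop)]
  refine lintegral_congr fun a => ?_
  rw [enorm_mul, div_eq_mul_inv, ENNReal.mul_inv (Or.inr ht) (Or.inr h0)]
  calc u (a * τ) * ‖a‖ₑ⁻¹ = (‖τ‖ₑ * ‖τ‖ₑ⁻¹) * (u (a * τ) * ‖a‖ₑ⁻¹) := by
        rw [ENNReal.mul_inv_cancel h0 ht, one_mul]
    _ = _ := by ring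

/-- The full admissibility integral is controlled by the one of the window condition and by the
tail bound. -/
theorem one_le_window_add_tail {u w : ℝ → ℝ≥0∞} (hu : Measurable u) (hw : Measurable w)
    (hadm : (∫⁻ t, u t / ‖t‖ₑ) * ∫⁻ r, w r = 1) {τ v : ℝ} (hτ : τ ≠ 0)
    (hv : v ∈ Set.Icc (-1 : ℝ) 1) :
    1 ≤ (∫⁻ a in Set.Icc (-1 : ℝ) 1, ∫⁻ s in Set.Icc (-2 : ℝ) 2,
        u (a * τ) * w ((v - s) / |a| ^ (1 / 2 : ℝ)) * ENNReal.ofReal (|a| ^ (-(3 / 2 : ℝ))))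
      + tailBound u (∫⁻ r, w r) (∫⁻ r, ‖r‖ₑ ^ 8 * w r) τ := by
  set W := ∫⁻ r, w r with hW
  set W8 := ∫⁻ r, ‖r‖ₑ ^ 8 * w r with hW8
  set K : ℝ → ℝ → ℝ≥0∞ := fun a s =>
    u (a * τ) * w ((v - s) / |a| ^ (1 / 2 : ℝ)) * ENNReal.ofReal (|a| ^ (-(3 / 2 : ℝ))) with hK
  have hKs : ∀ a, Measurable (K a) := fun a => by fun_prop
  -- Over all shears, rescaling `s` gives `|a|^{1/2}`, which turns `da/|a|^{3/2}` into the
  -- scale-invariant `da/|a|`.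
  have hfull : ∀ᵐ a : ℝ, ∫⁻ s, K a s = u (a * τ) * ‖a‖ₑ⁻¹ * W := by
    filter_upwards [ae_ne_zero] with a ha
    have hc := Real.rpow_pos_of_pos (abs_pos.2 ha) (1 / 2)
    simp only [hK]
    rw [lintegral_mul_const _ (by fun_prop), lintegral_const_mul _ (by fun_prop),
      lintegral_comp_sub_div hw v hc, ← hW, ← rpow_dilation ha]
    ring
  have htail : ∀ᵐ a : ℝ, ∫⁻ s in (Set.Icc (-2 : ℝ) 2)ᶜ, K a s ≤ u (a * τ) * (‖a‖ₑ ^ 3 * W8) := by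
    filter_upwards [ae_ne_zero] with a ha
    have ha' := abs_pos.2 ha
    obtain ⟨h0, ht⟩ := enorm_ne_zero_top ha
    have hc := Real.rpow_pos_of_pos ha' (1 / 2)
    have hc8 : (|a| ^ (1 / 2 : ℝ)) ^ 8 = |a| ^ 4 := by
      rw [← Real.rpow_natCast, ← Real.rpow_mul ha'.le, ← Real.rpow_natCast]
      norm_num
    -- For `|v| ≤ 1` and `|s| > 2` one has `|v - s| ≥ 1`, so `|a|⁴ |r|⁸ ≥ 1` with `r = (v -
    -- s)/|a|^{1/2}`.
    have hpt : ∀ s ∈ (Set.Icc (-2 : ℝ) 2)ᶜ, K a s ≤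
        u (a * τ) * (‖a‖ₑ ^ 4 * (‖(v - s) / |a| ^ (1 / 2 : ℝ)‖ₑ ^ 8 *
          w ((v - s) / |a| ^ (1 / 2 : ℝ)))) * ENNReal.ofReal (|a| ^ (-(3 / 2 : ℝ))) := by
      intro s hs
      simp only [hK]
      gcongr
      rw [← mul_assoc]
      refine le_mul_of_one_le_left' ?_
      have h1 : 1 ≤ |v - s| := by
        by_contra hlt
        have h2 := abs_lt.1 (not_le.1 hlt)
        exact hs ⟨by linarith [hv.1, h2.2], by linarith [hv.2, h2.1]⟩
      rw [Real.enorm_eq_ofReal_abs, Real.enorm_eq_ofReal_abs, ← ENNReal.ofReal_pow ha'.le,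
        ← ENNReal.ofReal_pow (abs_nonneg _), ← ENNReal.ofReal_mul (by positivity), ← hc8, abs_div,
        abs_of_pos hc, div_pow, mul_div_cancel₀ _ (by positivity)]
      exact ENNReal.one_le_ofReal.2 (one_le_pow₀ h1)
    have hG : Measurable fun r : ℝ => ‖r‖ₑ ^ 8 * w r := by fun_prop
    refine (setLIntegral_mono' measurableSet_Icc.compl hpt).trans
      ((setLIntegral_le_lintegral _ _).trans (le_of_eq ?_))
    rw [lintegral_mul_const _ (by fun_prop), lintegral_const_mul _ (by fun_prop),
      lintegral_const_mul _ (by fun_prop), lintegral_comp_sub_div hG v hc, ← hW8]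
    calc _ = u (a * τ) * ‖a‖ₑ ^ 4 * W8 * (ENNReal.ofReal (|a| ^ (-(3 / 2 : ℝ))) *
          ENNReal.ofReal (|a| ^ (1 / 2 : ℝ))) := by ring
      _ = u (a * τ) * (‖a‖ₑ ^ 3 * W8) * (‖a‖ₑ * ‖a‖ₑ⁻¹) := by rw [rpow_dilation ha]; ring
      _ = _ := by rw [ENNReal.mul_inv_cancel h0 ht, mul_one]
  have hm1 : Measurable fun a => ∫⁻ s in Set.Icc (-2 : ℝ) 2, K a s :=
    Measurable.lintegral_prod_right' (f := fun p : ℝ × ℝ => K p.1 p.2) (by fun_prop)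
  -- By invariance of `da/|a|` the full integral is the admissibility constant, whatever `τ ≠ 0` is.
  calc 1 = ∫⁻ a, u (a * τ) * ‖a‖ₑ⁻¹ * W := by
        rw [lintegral_mul_const _ (by fun_prop), lintegral_comp_mul_mul_inv hu hτ, hadm]
    _ ≤ ∫⁻ a, ((Set.Icc (-1 : ℝ) 1).indicator (fun a => ∫⁻ s in Set.Icc (-2 : ℝ) 2, K a s) a +
          u (a * τ) * ((Set.Icc (-1 : ℝ) 1).indicator (fun a => ‖a‖ₑ ^ 3 * W8) a +
            (Set.Icc (-1 : ℝ) 1)ᶜ.indicator (fun a => ‖a‖ₑ⁻¹ * W) a)) := by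
        refine lintegral_mono_ae ?_
        filter_upwards [hfull, htail] with a h1 h2
        by_cases hm : a ∈ Set.Icc (-1 : ℝ) 1
        · have hm' : a ∉ (Set.Icc (-1 : ℝ) 1)ᶜ := fun h => h hm
          rw [Set.indicator_of_mem hm, Set.indicator_of_mem hm, Set.indicator_of_notMem hm',
            add_zero, ← h1, ← lintegral_add_compl _ (measurableSet_Icc (a := (-2 : ℝ)) (b := 2))]
          gcongr
        · rw [Set.indicator_of_notMem hm, Set.indicator_of_notMem hm, Set.indicator_of_mem hm,
            zero_add, zero_add, mul_assoc]
    _ = _ := by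
        rw [lintegral_add_left (hm1.indicator measurableSet_Icc),
          lintegral_indicator measurableSet_Icc]
        rfl

/-! ### The product form and the decay of the window -/

theorem ae_first_coord_ne_zero : ∀ᵐ ξ : Plane, ξ 0 ≠ 0 := by
  have hm : MeasurableSet {ξ : Plane | ξ 0 ≠ 0} :=
    (measurableSet_eq_fun (f := fun ξ : Plane => ξ 0) (g := fun _ => 0)
      (by fun_prop) (by fun_prop)).compl
  rw [← measurePreserving_plane.map_eq,
    ae_map_iff measurePreserving_plane.measurable.aemeasurable hm]
  exact Measure.quasiMeasurePreserving_fst.ae ae_ne_zero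

theorem lintegral_product_form {m k : ℝ → ℝ≥0∞} (hm : Measurable m) (hk : Measurable k) :
    ∫⁻ ξ : Plane, m (ξ 0) * k (ξ 1 / ξ 0) = (∫⁻ τ, ‖τ‖ₑ * m τ) * ∫⁻ r, k r := by
  have hM : Measurable fun ξ : Plane => m (ξ 0) * k (ξ 1 / ξ 0) := by fun_prop
  rw [lintegral_slope hM.aemeasurable, ← lintegral_const_mul _ hk]
  refine lintegral_congr fun v => ?_
  rw [← lintegral_mul_const _ (by fun_prop)]
  refine lintegral_congr_ae ?_
  filter_upwards [ae_ne_zero] with τ hτ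
  simp only [Matrix.cons_val_zero, Matrix.cons_val_one]
  rw [mul_div_cancel_right₀ _ hτ, mul_assoc]

variable {ψ g : Plane → ℂ} {ψ₁ ψ₂ : ℝ → ℂ}

theorem admConst_eq
    (hprod : ∀ᵐ ξ : Plane, fourierL2 ψ ξ = fourierL2 ψ₁ (ξ 0) * fourierL2 ψ₂ (ξ 1 / ξ 0)) :
    admConst ψ = (∫⁻ τ, ‖fourierL2 ψ₁ τ‖ₑ ^ 2 / ‖τ‖ₑ) * ∫⁻ r, ‖fourierL2 ψ₂ r‖ₑ ^ 2 := by
  have hu := measurable_enorm_fourierL2 ψ₁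
  have hw := measurable_enorm_fourierL2 ψ₂
  have h1 := lintegral_product_form (m := fun τ => ‖fourierL2 ψ₁ τ‖ₑ ^ 2 / ‖τ‖ₑ ^ 2)
    (k := fun r => ‖fourierL2 ψ₂ r‖ₑ ^ 2) (by fun_prop) (by fun_prop)
  rw [admConst]
  refine Eq.trans (lintegral_congr_ae ?_) (h1.trans ?_)
  · filter_upwards [hprod] with ξ hξ
    rw [hξ, enorm_mul, mul_pow, ENNReal.div_eq_inv_mul, ENNReal.div_eq_inv_mul]
    ring
  · congr 1
    refine lintegral_congr_ae ?_
    filter_upwards [ae_ne_zero] with τ hτ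
    obtain ⟨h0, ht⟩ := enorm_ne_zero_top hτ
    rw [div_eq_mul_inv, div_eq_mul_inv, sq ‖τ‖ₑ, ENNReal.mul_inv (Or.inl h0) (Or.inl ht)]
    calc _ = ‖fourierL2 ψ₁ τ‖ₑ ^ 2 * ‖τ‖ₑ⁻¹ * (‖τ‖ₑ * ‖τ‖ₑ⁻¹) := by ring
      _ = _ := by rw [ENNReal.mul_inv_cancel h0 ht, mul_one]

/-- Smoothness of the shearlet in the sense of `L²` gives moments of its second factor. -/
theorem lintegral_moment_eight
    (hprod : ∀ᵐ ξ : Plane, fourierL2 ψ ξ = fourierL2 ψ₁ (ξ 0) * fourierL2 ψ₂ (ξ 1 / ξ 0))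
    (hψ₁_pos : 0 < ∫⁻ τ : ℝ, ‖fourierL2 ψ₁ τ‖ₑ ^ 2 / ‖τ‖ₑ)
    (hs : ContDiff ℝ ∞ ψ) (hd : ∀ n : ℕ, MemLp (iteratedFDeriv ℝ n ψ) 2 volume) :
    ∫⁻ r, ‖r‖ₑ ^ 8 * ‖fourierL2 ψ₂ r‖ₑ ^ 2 < ⊤ := by
  have hu := measurable_enorm_fourierL2 ψ₁
  have hw := measurable_enorm_fourierL2 ψ₂
  have h1 := lintegral_product_form (m := fun τ => ‖τ‖ₑ ^ 8 * ‖fourierL2 ψ₁ τ‖ₑ ^ 2)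
    (k := fun r => ‖r‖ₑ ^ 8 * ‖fourierL2 ψ₂ r‖ₑ ^ 2) (by fun_prop) (by fun_prop)
  -- The fourth derivative along the second axis puts `|ξ₂|⁸ |ℱψ|²` in `L¹`; with `ξ₂ = ξ₁ (ξ₂/ξ₁)`
  -- this splits into a product of two one-dimensional integrals.
  have h2 := lintegral_inner_pow_fourierL2 hs hd !₂[0, 1] 4
  have h3 : ∫⁻ ξ : Plane, (‖(inner ℝ ξ (!₂[0, 1] : Plane) : ℝ)‖ₑ ^ 4 * ‖fourierL2 ψ ξ‖ₑ) ^ 2 =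
      ∫⁻ ξ : Plane, ‖ξ 0‖ₑ ^ 8 * ‖fourierL2 ψ₁ (ξ 0)‖ₑ ^ 2 *
        (‖ξ 1 / ξ 0‖ₑ ^ 8 * ‖fourierL2 ψ₂ (ξ 1 / ξ 0)‖ₑ ^ 2) := by
    refine lintegral_congr_ae ?_
    filter_upwards [hprod, ae_first_coord_ne_zero] with ξ hξ h0
    have e1 : (inner ℝ ξ (!₂[0, 1] : Plane) : ℝ) = ξ 0 * (ξ 1 / ξ 0) := by
      rw [inner_plane, mul_div_cancel₀ _ h0]; simp
    rw [hξ, e1, enorm_mul, enorm_mul]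
    ring
  rw [h3, h1] at h2
  -- The other factor is nonzero: its vanishing would make `ℱψ₁` zero almost everywhere, against
  -- `hψ₁_pos`.
  refine ENNReal.lt_top_of_mul_ne_top_right h2.ne fun h0 => hψ₁_pos.ne' ?_
  rw [lintegral_eq_zero_iff (by fun_prop)] at h0 ⊢
  filter_upwards [h0, ae_ne_zero] with τ h4 h5
  have h6 := (enorm_ne_zero_top h5).1
  have h7 : ‖fourierL2 ψ₁ τ‖ₑ ^ 2 = 0 := by simpa [h6, h5] using h4
  simp only [h7, ENNReal.zero_div, Pi.zero_apply]

theorem ae_one_le_shearletWeight_add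
    (hprod : ∀ᵐ ξ : Plane, fourierL2 ψ ξ = fourierL2 ψ₁ (ξ 0) * fourierL2 ψ₂ (ξ 1 / ξ 0))
    (hψ_adm : admConst ψ = 1) :
    ∀ᵐ ξ : Plane, ξ ∈ coneH → 1 ≤ shearletWeight ψ ξ +
      tailBound (fun τ => ‖fourierL2 ψ₁ τ‖ₑ ^ 2) (∫⁻ r, ‖fourierL2 ψ₂ r‖ₑ ^ 2)
        (∫⁻ r, ‖r‖ₑ ^ 8 * ‖fourierL2 ψ₂ r‖ₑ ^ 2) (ξ 0) := by
  have hu := measurable_enorm_fourierL2 ψ₁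
  have hw := measurable_enorm_fourierL2 ψ₂
  have hs := stronglyMeasurable_fourierL2 ψ
  have hs1 := (stronglyMeasurable_fourierL2 ψ₁).measurable
  have hs2 := (stronglyMeasurable_fourierL2 ψ₂).measurable
  have hP : Measurable fun ξ : Plane => fourierL2 ψ₁ (ξ 0) * fourierL2 ψ₂ (ξ 1 / ξ 0) := by
    fun_prop
  have h1 := ae_ae_dil_shear (p := fun a s ξ =>
      fourierL2 ψ (act (dil a) (act (shear s).transpose ξ)) =
        fourierL2 ψ₁ (act (dil a) (act (shear s).transpose ξ) 0) *
        fourierL2 ψ₂ (act (dil a) (act (shear s).transpose ξ) 1 /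
          act (dil a) (act (shear s).transpose ξ) 0))
    (measurableSet_eq_fun (hs.measurable.comp measurable_dil_shear)
      (hP.comp measurable_dil_shear))
    (fun a s ha => ae_comp_dil_shear hprod s ha)
  rw [admConst_eq hprod] at hψ_adm
  filter_upwards [h1, ae_first_coord_ne_zero] with ξ h2 h0 hξ
  have hv : ξ 1 / ξ 0 ∈ Set.Icc (-1 : ℝ) 1 := by
    rw [Set.mem_Icc, ← abs_le, abs_div]
    exact div_le_one_of_le₀ hξ (abs_nonneg _)
  refine (one_le_window_add_tail (u := fun τ => ‖fourierL2 ψ₁ τ‖ₑ ^ 2)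
    (w := fun r => ‖fourierL2 ψ₂ r‖ₑ ^ 2) (by fun_prop) (by fun_prop) hψ_adm h0 hv).trans
    (le_of_eq ?_)
  congr 1
  refine lintegral_congr_ae (ae_restrict_of_ae ?_)
  filter_upwards [h2, ae_ne_zero] with a h3 ha
  refine lintegral_congr_ae (ae_restrict_of_ae ?_)
  filter_upwards [h3] with s h4
  rw [h4, enorm_mul, mul_pow, act_dil_shear]
  have e := slope_dil_shear ha h0 s (ξ 1 / ξ 0)
  rw [div_mul_cancel₀ _ h0] at e
  simp only [Matrix.cons_val_zero, Matrix.cons_val_one]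
  rw [e]

/-- `D` is the shearlet weight of a cone; the window condition makes it finite, so it can be
cancelled. -/
theorem enorm_sq_le_of_cone {G D R : ℝ≥0∞} (h1 : G + D ≤ 1) (h2 : 1 ≤ D + R) : G ≤ R := by
  have hD : D ≠ ⊤ := ((le_add_self.trans h1).trans_lt ENNReal.one_lt_top).ne
  have h3 : D + G ≤ D + R := by rw [add_comm D G]; exact h1.trans h2
  exact (ENNReal.add_le_add_iff_left hD).1 h3

theorem ae_window_le_tailBound
    (hprod : ∀ᵐ ξ : Plane, fourierL2 ψ ξ = fourierL2 ψ₁ (ξ 0) * fourierL2 ψ₂ (ξ 1 / ξ 0))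
    (hψ_adm : admConst ψ = 1) (hW : WindowCondition ψ g) :
    ∀ᵐ ξ : Plane,
      (ξ ∈ coneH → ‖fourierL2 g ξ‖ₑ ^ 2 ≤
        tailBound (fun τ => ‖fourierL2 ψ₁ τ‖ₑ ^ 2) (∫⁻ r, ‖fourierL2 ψ₂ r‖ₑ ^ 2)
        (∫⁻ r, ‖r‖ₑ ^ 8 * ‖fourierL2 ψ₂ r‖ₑ ^ 2) (ξ 0)) ∧
      (ξ ∈ coneV → ‖fourierL2 g ξ‖ₑ ^ 2 ≤
        tailBound (fun τ => ‖fourierL2 ψ₁ τ‖ₑ ^ 2) (∫⁻ r, ‖fourierL2 ψ₂ r‖ₑ ^ 2)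
        (∫⁻ r, ‖r‖ₑ ^ 8 * ‖fourierL2 ψ₂ r‖ₑ ^ 2) (ξ 1)) := by
  have h1 := ae_one_le_shearletWeight_add hprod hψ_adm
  filter_upwards [windowCondition_swap hW, h1, ae_swapPt h1] with ξ h2 h3 h4
  refine ⟨fun hξ => enorm_sq_le_of_cone ?_ (h3 hξ), fun hξ => enorm_sq_le_of_cone ?_ (h4 hξ)⟩
  · rw [Set.indicator_of_mem hξ] at h2
    exact le_self_add.trans h2.le
  · rw [Set.indicator_of_mem hξ, add_right_comm] at h2
    exact le_self_add.trans h2.le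

/-- Slopes `|v| ≤ 1` use the horizontal cone and the tail bound at `τ`. Steeper slopes use the
vertical cone and the tail bound at `vτ`, and a dilation by `v` costs only a finite factor. -/
theorem ae_slice_of_shearlet_smooth
    (hprod : ∀ᵐ ξ : Plane, fourierL2 ψ ξ = fourierL2 ψ₁ (ξ 0) * fourierL2 ψ₂ (ξ 1 / ξ 0))
    (hψ_adm : admConst ψ = 1) (hW : WindowCondition ψ g)
    (hψ₁_pos : 0 < ∫⁻ τ : ℝ, ‖fourierL2 ψ₁ τ‖ₑ ^ 2 / ‖τ‖ₑ)
    (hψ₁_two : ∫⁻ τ : ℝ, ‖τ‖ₑ ^ 2 * ‖fourierL2 ψ₁ τ‖ₑ ^ 2 < ⊤)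
    (hs : ContDiff ℝ ∞ ψ) (hd : ∀ n : ℕ, MemLp (iteratedFDeriv ℝ n ψ) 2 volume) :
    ∀ᵐ v : ℝ, ∫⁻ τ, ‖τ‖ₑ ^ 2 * ‖fourierL2 g !₂[τ, v * τ]‖ₑ ^ 2 < ⊤ := by
  have hu : Measurable fun τ => ‖fourierL2 ψ₁ τ‖ₑ ^ 2 := (measurable_enorm_fourierL2 ψ₁).pow_const 2
  have hWfin := (memLp_two_iff.1 (memLp_fourierL2 ψ₂)).2
  have hW8 := lintegral_moment_eight hprod hψ₁_pos hs hd
  have hR := lintegral_sq_mul_tailBound hu hWfin hW8 hψ₁_two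
  have hRm := measurable_tailBound hu (∫⁻ r, ‖fourierL2 ψ₂ r‖ₑ ^ 2)
    (∫⁻ r, ‖r‖ₑ ^ 8 * ‖fourierL2 ψ₂ r‖ₑ ^ 2)
  filter_upwards [ae_slope (ae_window_le_tailBound hprod hψ_adm hW)] with v hv
  by_cases hm : v ∈ Set.Icc (-1 : ℝ) 1
  · refine lt_of_le_of_lt (lintegral_mono_ae ?_) hR
    filter_upwards [hv, ae_ne_zero] with τ h1 h0
    gcongr
    exact h1.1 ((slope_mem_coneH h0).2 hm)
  · have hv1 : 1 < |v| := by
      by_contra hlt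
      exact hm (abs_le.1 (not_lt.1 hlt))
    have hv0 : v ≠ 0 := abs_pos.1 (by linarith)
    have h2 := lintegral_sq_mul_comp hRm hv0
    refine lt_of_le_of_lt (lintegral_mono_ae ?_) (lt_of_eq_of_lt h2 (ENNReal.mul_lt_top
      (ENNReal.pow_lt_top (ENNReal.inv_lt_top.2 (pos_iff_ne_zero.2 (enorm_ne_zero_top hv0).1))) hR))
    filter_upwards [hv] with τ h1
    gcongr
    refine h1.2 (show |τ| ≤ |v * τ| from ?_)
    rw [abs_mul]
    nlinarith [abs_nonneg τ]

theorem ae_slice_of_window_smooth (hs : ContDiff ℝ ∞ g)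
    (hd : ∀ n : ℕ, MemLp (iteratedFDeriv ℝ n g) 2 volume) :
    ∀ᵐ v : ℝ, ∫⁻ τ, ‖τ‖ₑ ^ 2 * ‖fourierL2 g !₂[τ, v * τ]‖ₑ ^ 2 < ⊤ := by
  have hm := measurable_enorm_fourierL2 g
  have h1 := lintegral_inner_pow_fourierL2 hs hd !₂[1, 0] 1
  have h2 := (memLp_two_iff.1 (memLp_fourierL2 g)).2
  -- `|ξ₁| ≤ |ξ₁|² + 1`, so one derivative of `g` suffices; the Jacobian of slope coordinates then
  -- raises `|τ|` to `|τ|²`.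
  have h3 : ∫⁻ ξ : Plane, ‖ξ 0‖ₑ * ‖fourierL2 g ξ‖ₑ ^ 2 < ⊤ := by
    refine lt_of_le_of_lt (lintegral_mono fun ξ => ?_)
      (lt_of_eq_of_lt (lintegral_add_right _ (by fun_prop)) (ENNReal.add_lt_top.2 ⟨h1, h2⟩))
    have e1 : (inner ℝ ξ (!₂[1, 0] : Plane) : ℝ) = ξ 0 := by
      rw [inner_plane]; simp
    simp only [e1, pow_one, mul_pow]
    rw [← add_one_mul]
    gcongr
    rcases le_total ‖ξ 0‖ₑ 1 with h | h
    · exact le_add_left h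
    · exact le_add_right (le_self_pow₀ h two_ne_zero)
  have hm3 : Measurable fun ξ : Plane => ‖ξ 0‖ₑ * ‖fourierL2 g ξ‖ₑ ^ 2 := by fun_prop
  rw [lintegral_slope hm3.aemeasurable] at h3
  have hm4 : Measurable fun v : ℝ => ∫⁻ τ, ‖τ‖ₑ *
      (‖(!₂[τ, v * τ] : Plane) 0‖ₑ * ‖fourierL2 g !₂[τ, v * τ]‖ₑ ^ 2) :=
    Measurable.lintegral_prod_right' (f := fun p : ℝ × ℝ => ‖p.2‖ₑ *
      (‖(!₂[p.2, p.1 * p.2] : Plane) 0‖ₑ * ‖fourierL2 g !₂[p.2, p.1 * p.2]‖ₑ ^ 2))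
      (Measurable.mul (by fun_prop) (hm3.comp measurable_slopeMap))
  filter_upwards [ae_lt_top hm4 h3.ne] with v hv
  refine lt_of_eq_of_lt (lintegral_congr fun τ => ?_) hv
  simp only [Matrix.cons_val_zero]
  ring

/-- The first condition needs only `g ∈ L¹ ∩ L²`, since `|τ| |ℱg(τ, vτ)|²` is integrable on almost
every slice; the second, with symbol `|τ|`, is what the hypothesis provides. -/
theorem ae_memDomJ0 (hg₁ : Integrable g) (hg₂ : MemLp g 2 volume)
    (h : ∀ᵐ v : ℝ, ∫⁻ τ, ‖τ‖ₑ ^ 2 * ‖fourierL2 g !₂[τ, v * τ]‖ₑ ^ 2 < ⊤) :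
    ∀ᵐ v : ℝ, MemDomJ0 (radonH g v) ∧ MemDomJ0 (J0 (radonH g v)) := by
  filter_upwards [h, ae_lintegral_slice hg₁ hg₂, ae_memLp_radonH hg₁ hg₂,
    ae_slope (fourierL2_ae_eq_fourier hg₁ hg₂)] with v h1 h2 h3 h4
  have hF := fourierL2_radonH hg₁ h3
  have hm := (stronglyMeasurable_fourierL2 (radonH g v)).aestronglyMeasurable (μ := volume)
  have hd : MemDomJ0 (radonH g v) := by
    refine ⟨h3, memLp_two_iff.2 ⟨AEStronglyMeasurable.mul
      (Measurable.aestronglyMeasurable (by fun_prop)) hm, lt_of_eq_of_lt (lintegral_congr_ae ?_) h2⟩⟩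
    filter_upwards [hF] with τ h5
    have hp : 0 ≤ |τ| ^ (1 / 2 : ℝ) := Real.rpow_nonneg (abs_nonneg τ) _
    rw [h5, fourier_radonH hg₁, enorm_mul, mul_pow, enorm_ofReal, Real.enorm_eq_ofReal hp,
      ← ENNReal.ofReal_pow hp, sq, abs_rpow_half_mul_self, ← Real.enorm_eq_ofReal_abs]
  refine ⟨hd, memDomJ0_J0_of_memLp hd (memLp_abs_mul_fourierL2
    (lt_of_eq_of_lt (lintegral_congr_ae ?_) h1))⟩
  filter_upwards [hF, h4] with τ h5 h6
  rw [h5, h6]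

end Domain

end ConeShearlet

open ConeShearlet in
theorem theorem3p3
    (ψ : Plane → ℂ) (ψ₁ ψ₂ : ℝ → ℂ)
    -- `ψ` is square-integrable and smooth, with vanishing moments, admissible with constant one
    (hψ : MemLp ψ 2 volume) (hψ_smooth : ContDiff ℝ ∞ ψ)
    (hψ_moments : VanishingMoments ψ) (hψ_adm : admConst ψ = 1)
    -- `ψ` is of product form
    (hψ₁ : MemLp ψ₁ 2 volume) (hψ₂ : MemLp ψ₂ 2 volume)
    (hprod : ∀ᵐ ξ : Plane, fourierL2 ψ ξ = fourierL2 ψ₁ (ξ 0) * fourierL2 ψ₂ (ξ 1 / ξ 0))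
    -- conditions on `ψ₁`
    (hψ₁_pos : 0 < ∫⁻ τ : ℝ, ‖fourierL2 ψ₁ τ‖ₑ ^ 2 / ‖τ‖ₑ)
    (hψ₁_fin : ∫⁻ τ : ℝ, ‖fourierL2 ψ₁ τ‖ₑ ^ 2 / ‖τ‖ₑ < ⊤)
    (hψ₁_one : ∫⁻ τ : ℝ, ‖τ‖ₑ * ‖fourierL2 ψ₁ τ‖ₑ ^ 2 < ⊤)
    (hψ₁_two : ∫⁻ τ : ℝ, ‖τ‖ₑ ^ 2 * ‖fourierL2 ψ₁ τ‖ₑ ^ 2 < ⊤)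
    -- the window
    (g : Plane → ℂ) (hg_smooth : ContDiff ℝ ∞ g) (hg₁ : Integrable g volume)
    (hg₂ : MemLp g 2 volume) (hW : WindowCondition ψ g)
    -- the signal
    (f : Plane → ℂ) (hf₁ : Integrable f volume) (hf₂ : MemLp f 2 volume) :
    -- the reconstruction formula
    (eLpNorm f 2 volume ^ 2 =
        (∫⁻ b : Plane, ‖ip f (translateBy b g)‖ₑ ^ 2)
        + (∫⁻ a in Set.Icc (-1 : ℝ) 1, ∫⁻ s in Set.Icc (-2 : ℝ) 2, ∫⁻ b : Plane,
            ‖shearletTransform ψ (freqProj coneH f) b s a‖ₑ ^ 2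
              * ENNReal.ofReal (|a| ^ (-(3 : ℝ))))
        + (∫⁻ a in Set.Icc (-1 : ℝ) 1, ∫⁻ s in Set.Icc (-2 : ℝ) 2, ∫⁻ b : Plane,
            ‖shearletTransformV (swapped ψ) (freqProj coneV f) b s a‖ₑ ^ 2
              * ENNReal.ofReal (|a| ^ (-(3 : ℝ))))) ∧
    -- almost every slice of the Radon transforms is square-integrable
    (∀ᵐ v : ℝ, MemLp (radonH f v) 2 volume ∧ MemLp (radonV f v) 2 volume) ∧
    -- the horizontal and the vertical shearlet coefficients
    (∀ x y s a : ℝ, a ≠ 0 →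
      IntervalIntegrable (fun v : ℝ =>
          waveletTransform (chiOne ψ₁) (radonH f v) (x + v * y) a
            * star (fourierL2 ψ₂ ((v - s) / |a| ^ (1 / 2 : ℝ)))) volume (-1) 1 ∧
      shearletTransform ψ (freqProj coneH f) !₂[x, y] s a =
        ((|a| ^ (-(3 / 4 : ℝ)) : ℝ) : ℂ) * ∫ v in (-1 : ℝ)..1,
          waveletTransform (chiOne ψ₁) (radonH f v) (x + v * y) a
            * star (fourierL2 ψ₂ ((v - s) / |a| ^ (1 / 2 : ℝ)))) ∧
    (∀ x y s a : ℝ, a ≠ 0 →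
      IntervalIntegrable (fun v : ℝ =>
          waveletTransform (chiOne ψ₁) (radonV f v) (v * x + y) a
            * star (fourierL2 ψ₂ ((v - s) / |a| ^ (1 / 2 : ℝ)))) volume (-1) 1 ∧
      shearletTransformV (swapped ψ) (freqProj coneV f) !₂[x, y] s a =
        ((|a| ^ (-(3 / 4 : ℝ)) : ℝ) : ℂ) * ∫ v in (-1 : ℝ)..1,
          waveletTransform (chiOne ψ₁) (radonV f v) (v * x + y) a
            * star (fourierL2 ψ₂ ((v - s) / |a| ^ (1 / 2 : ℝ)))) ∧
    -- the window coefficients, with `ζ(v, ·) = J₀² ℛg(v, ·)`, whenever `ζ` is defined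
    ((∀ᵐ v : ℝ, MemDomJ0 (radonH g v) ∧ MemDomJ0 (J0 (radonH g v))) →
      ∀ x y : ℝ,
        Integrable (fun v : ℝ =>
          ip (radonH f v) (translateBy (x + v * y) (J0 (J0 (radonH g v))))) volume ∧
        ip f (translateBy !₂[x, y] g) =
          ∫ v : ℝ, ip (radonH f v) (translateBy (x + v * y) (J0 (J0 (radonH g v))))) ∧
    -- `ζ` is defined as soon as `ψ` or `g` is smooth in the sense of `L²`
    (((∀ n : ℕ, MemLp (iteratedFDeriv ℝ n ψ) 2 volume) ∨
        (∀ n : ℕ, MemLp (iteratedFDeriv ℝ n g) 2 volume)) →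
      ∀ᵐ v : ℝ, MemDomJ0 (radonH g v) ∧ MemDomJ0 (J0 (radonH g v))) := by
  have hfs : Integrable fun x => f (swapPt x) :=
    measurePreserving_swapPt.integrable_comp_of_integrable hf₁
  have hfs₂ : MemLp (fun x => f (swapPt x)) 2 volume := memLp_comp_swapPt hf₂
  refine ⟨reconstruction hψ hg₂ hW hf₂, ?_, ?_, ?_, ?_, ?_⟩
  · filter_upwards [ae_memLp_radonH hf₁ hf₂, ae_memLp_radonH hfs hfs₂] with v h1 h2
    exact ⟨h1, h2⟩
  · exact fun x y s a ha => shearlet_coefficients hψ hprod hψ₁_two hf₁ hf₂ x y s ha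
  · intro x y s a ha
    -- Exchanging the coordinates also exchanges `x` and `y`, whence the translation parameter `y +
    -- v * x`.
    have h := shearlet_coefficients hψ hprod hψ₁_two hfs hfs₂ y x s ha
    rw [shearletTransformV_eq hψ hf₂ _ s ha, radonV_eq_radonH]
    simp only [add_comm _ y]
    exact h
  · exact fun hdom x y => window_coefficients hf₁ hf₂ hg₁ hg₂ hdom x y
  · rintro (hd | hd)
    · exact ae_memDomJ0 hg₁ hg₂ (ae_slice_of_shearlet_smooth hprod hψ_adm hW hψ₁_pos hψ₁_two
        hψ_smooth hd)
    · exact ae_memDomJ0 hg₁ hg₂ (ae_slice_of_window_smooth hg_smooth hd)
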